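/- Let $a_1>a_2>a_3$ and $b_1,b_2,b_3$ be real, put $n_{ij}=\frac{b_i-b_j}{a_i-a_j}$ and assume $n_{23}>n_{13}>n_{12}$. Let $\mathcal N_1=\{1,\dots,N_1\}$, $\mathcal N_2=\{N_1+1,\dots,N_1+N_2\}$, $\mathcal N=\mathcal N_1\cup\mathcal N_2$; let $z_n$ $(n\in\mathcal N)$ be distinct points with $\operatorname{Im}z_n>0$, let $c_n\in\mathbb C\setminus\{0\}$, and let $r_1\in L^2(\mathbb R)$. **Soliton solutions.** For $S\subseteq\mathcal N$ and constants $k_n\ (n\in S)$, the soliton solution with reflectionless data $\{z_n,k_n\}_{n\in S}$ is $$p_{ij}(x,t)=-i(a_i-a_j)\lim_{z\to\infty}[zN(z)]_{ij},\qquad i,j=1,2,3,$$ where the $3\times3$ matrix function $N(z)=N(z;x,t)$ is analytic off the points $z_n,\bar z_n$ $(n\in S)$, satisfies $N(z)=I+\mathcal O(z^{-1})$ as $z\to\infty$ and $N(z)=\overline{N^A(\bar z)}$ ($N^A$ is the cofactor matrix), and has simple poles with $\operatorname{Res}_{z=z_n}N=\lim_{z\to z_n}N(z)\Gamma_n$ and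 $\operatorname{Res}_{z=\bar z_n}N=\lim_{z\to\bar z_n}N(z)\tilde\Gamma_n$. With $E_{ij}$ the matrix units and $t\theta_{ij}=(a_i-a_j)x+(b_i-b_j)t$, here $\Gamma_n=k_ne^{iz_nt\theta_{12}}E_{12}$, $\tilde\Gamma_n=-\bar k_ne^{-i\bar z_nt\theta_{12}}E_{21}$ for $n\in\mathcal N_1$, and $\Gamma_n=k_ne^{iz_nt\theta_{23}}E_{23}$, $\tilde\Gamma_n=-\bar k_ne^{-i\bar z_nt\theta_{23}}E_{32}$ for $n\in\mathcal N_2$. **Modified data.** Let $\xi=x/t$, and $I(\xi)=\emptyset$ if $\xi>-n_{12}$, $I(\xi)=\mathbb R$ if $-n_{13}<\xi<-n_{12}$. Put $$\delta(z)=\exp\Big(i\int_{I(\xi)}\frac{\nu(s)}{s-z}\,ds\Big),\qquad \nu(s)=-\frac1{2\pi}\log(1+|r_1(s)|^2).$$ For constants $k_n$ let $\tilde k_n=k_n\delta(z_n)^{-2}$ if $n\in\mathcal N_1$ and $\tilde k_n=k_n\delta(z_n)$ if $n\in\mathcal N_2$. Let $\tilde{\mathcal D}=\{z_n,\tilde c_n\}_{n\in\mathcal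 N}$. **Restriction to a cone.** Let $x_1\le x_2$, $v_1\le v_2$ be real and $C(x_1,x_2,v_1,v_2)=\{(x,t): x=x_0+vt,\ x_0\in[x_1,x_2],\ v\in[v_1,v_2]\}$. Let $v_{z_n}=-n_{12}$ for $n\in\mathcal N_1$, $v_{z_n}=-n_{23}$ for $n\in\mathcal N_2$, and $\mathcal Z(I)=\{n\in\mathcal N: v_1<v_{z_n}<v_2\}$. Put $\Pi_i(z)=\prod_{n\in\mathcal N_i,\ v_{z_n}>v_2}\frac{z-\bar z_n}{z-z_n}$, let $c_n(I)=c_n\Pi_2(z_n)$ for $n\in\mathcal N_1\cap\mathcal Z(I)$ and $c_n(I)=c_n\Pi_1(z_n)$ for $n\in\mathcal N_2\cap\mathcal Z(I)$, and let $\tilde{\mathcal D}(I)=\{z_n,\tilde c_n(I)\}_{n\in\mathcal Z(I)}$, where $\tilde c_n(I)$ arises from $c_n(I)$ by the modification above. **Claim.** For all $x\in\mathbb R$, $t>0$ with $\xi>-n_{12}$ or $-n_{13}<\xi<-n_{12}$, the values $p^{sol}_{ij}(x,t;\tilde{\mathcal D})$ and $p^{sol}_{ij}(x,t;\tilde{\mathcal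 D}(I))$ of the soliton solutions exist and are unique. Let $a=\min\{a_1-a_2,a_2-a_3\}$ and, if $\mathcal Z(I)\ne\mathcal N$, let $$\mu(I)=\min_{n\in\mathcal N\setminus\mathcal Z(I)}\ \min_{i=1,2}\ \operatorname{Im}(z_n)\,|v_i-v_{z_n}|,$$ which is positive if neither $v_1$ nor $v_2$ is one of the $v_{z_n}$. Then, as $t\to\infty$ with $(x,t)\in C(x_1,x_2,v_1,v_2)$ and $\xi$ in one of these two ranges, $$p_{ij}^{sol}(x,t;\tilde{\mathcal D})=p_{ij}^{sol}(x,t;\tilde{\mathcal D}(I))+\mathcal O\big(e^{-a\mu(I)t}\big),\qquad i,j=1,2,3,$$ with implied constant independent of $(x,t)$. If $\mathcal Z(I)=\mathcal N$, the two solutions coincide. -/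

import Mathlib

open Filter Topology Asymptotics MeasureTheory

noncomputable section

namespace ThreeWave

/-- The wave speeds `n_ij = (b_i - b_j) / (a_i - a_j)`; indices run over `0, 1, 2`. -/
def speed (a b : Fin 3 → ℝ) (i j : Fin 3) : ℝ := (b i - b j) / (a i - a j)

/-- The phase `t θ_ij = (a_i - a_j) x + (b_i - b_j) t`. -/
def phase (a b : Fin 3 → ℝ) (i j : Fin 3) (x t : ℝ) : ℝ := (a i - a j) * x + (b i - b j) * t

/-- Index set of the discrete spectrum: `inl` for the first family (zeros of `s₁₁`),
`inr` for the second family (zeros of the cofactor `s₃₃^A`). -/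
abbrev PoleIndex (N₁ N₂ : ℕ) : Type := Fin N₁ ⊕ Fin N₂

variable {N₁ N₂ : ℕ}

/-- Nilpotent residue matrix at a pole `w` in the upper half plane with norming constant `k`. -/
def residueMatrix (a b : Fin 3 → ℝ) (x t : ℝ) (n : PoleIndex N₁ N₂) (w k : ℂ) :
    Matrix (Fin 3) (Fin 3) ℂ :=
  match n with
  | .inl _ => Matrix.single 0 1 (k * Complex.exp (Complex.I * w * (phase a b 0 1 x t : ℂ)))
  | .inr _ => Matrix.single 1 2 (k * Complex.exp (Complex.I * w * (phase a b 1 2 x t : ℂ)))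

/-- Nilpotent residue matrix at the conjugate pole; its norming constant is `-conj k`, which is
the only value compatible with the symmetry of the Riemann-Hilbert problem. -/
def residueMatrixConj (a b : Fin 3 → ℝ) (x t : ℝ) (n : PoleIndex N₁ N₂) (w k : ℂ) :
    Matrix (Fin 3) (Fin 3) ℂ :=
  match n with
  | .inl _ => Matrix.single 1 0
      (-(star k) * Complex.exp (-Complex.I * star w * (phase a b 0 1 x t : ℂ)))
  | .inr _ => Matrix.single 2 1
      (-(star k) * Complex.exp (-Complex.I * star w * (phase a b 1 2 x t : ℂ)))

/-- `N` has at most a simple pole at `w`, and `Res_{z = w} N = lim_{z → w} N(z) Γ`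
(both limits exist). -/
def HasResidueCondition (N : ℂ → Matrix (Fin 3) (Fin 3) ℂ) (w : ℂ)
    (Γ : Matrix (Fin 3) (Fin 3) ℂ) : Prop :=
  ∃ R : Matrix (Fin 3) (Fin 3) ℂ,
    Tendsto (fun z => (z - w) • N z) (𝓝[≠] w) (𝓝 R) ∧
    Tendsto (fun z => N z * Γ) (𝓝[≠] w) (𝓝 R)

/-- The poles `z_n` and `conj z_n`, for `n ∈ S`. -/
def poleSet (S : Finset (PoleIndex N₁ N₂)) (z : PoleIndex N₁ N₂ → ℂ) : Set ℂ :=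
  {w | ∃ n ∈ S, w = z n ∨ w = star (z n)}

/-- `N` solves, at `(x, t)`, the reflectionless Riemann-Hilbert problem with discrete data
`{(z_n, k_n)}_{n ∈ S}`. The jump on the real line is trivial, so `N` is analytic there. -/
structure IsReflectionlessSolution (a b : Fin 3 → ℝ) (S : Finset (PoleIndex N₁ N₂))
    (z k : PoleIndex N₁ N₂ → ℂ) (x t : ℝ) (N : ℂ → Matrix (Fin 3) (Fin 3) ℂ) : Prop where
  analytic : ∀ i j, DifferentiableOn ℂ (fun w => N w i j) (poleSet S z)ᶜ
  /-- `N(z)` is the complex conjugate of the cofactor matrix of `N(conj z)`. -/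
  symmetry : ∀ w ∉ poleSet S z, N w = (N (star w)).adjugate.conjTranspose
  normalization : ∀ i j, (fun w => N w i j - (1 : Matrix (Fin 3) (Fin 3) ℂ) i j)
    =O[Bornology.cobounded ℂ] (fun w => w⁻¹)
  residue : ∀ n ∈ S, HasResidueCondition N (z n) (residueMatrix a b x t n (z n) (k n))
  residue_conj : ∀ n ∈ S,
    HasResidueCondition N (star (z n)) (residueMatrixConj a b x t n (z n) (k n))

/-- `p = (p_ij)` is the value at `(x, t)` of the soliton solution with reflectionless data
`{(z_n, k_n)}_{n ∈ S}`: `p_ij = -i (a_i - a_j) lim_{z → ∞} z N_ij(z)`. -/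
def IsSolitonValue (a b : Fin 3 → ℝ) (S : Finset (PoleIndex N₁ N₂))
    (z k : PoleIndex N₁ N₂ → ℂ) (x t : ℝ) (p : Matrix (Fin 3) (Fin 3) ℂ) : Prop :=
  ∃ N : ℂ → Matrix (Fin 3) (Fin 3) ℂ, IsReflectionlessSolution a b S z k x t N ∧
    ∀ i j, Tendsto (fun w => -Complex.I * ((a i - a j : ℝ) : ℂ) * (w * N w i j))
      (Bornology.cobounded ℂ) (𝓝 (p i j))

/-- The set `I(ξ)`: empty for `ξ > -n₁₂`, the whole line for `-n₁₃ < ξ < -n₁₂`. -/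
def reflectionSet (a b : Fin 3 → ℝ) (ξ : ℝ) : Set ℝ :=
  {_s | ξ < -speed a b 0 1}

/-- `ν(s) = -(1 / 2π) log (1 + |r₁(s)|²)`. -/
def nu (r₁ : ℝ → ℂ) (s : ℝ) : ℝ := -(1 / (2 * Real.pi)) * Real.log (1 + ‖r₁ s‖ ^ 2)

/-- `δ(w, ξ) = exp (i ∫_{I(ξ)} ν(s) / (s - w) ds)`. -/
def delta (a b : Fin 3 → ℝ) (r₁ : ℝ → ℂ) (ξ : ℝ) (w : ℂ) : ℂ :=
  Complex.exp (Complex.I * ∫ s in reflectionSet a b ξ, (nu r₁ s : ℂ) / ((s : ℂ) - w))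

/-- The modification by the reflection coefficient: `k_n δ(z_n)⁻²` for the first family and
`k_n δ(z_n)` for the second. -/
def modifiedNorming (a b : Fin 3 → ℝ) (r₁ : ℝ → ℂ) (ξ : ℝ) (z k : PoleIndex N₁ N₂ → ℂ) :
    PoleIndex N₁ N₂ → ℂ
  | .inl m => k (.inl m) * (delta a b r₁ ξ (z (.inl m)) ^ 2)⁻¹
  | .inr m => k (.inr m) * delta a b r₁ ξ (z (.inr m))

/-- The cone `C(x₁, x₂, v₁, v₂)`. -/
def cone (x₁ x₂ v₁ v₂ : ℝ) : Set (ℝ × ℝ) :=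
  {q | ∃ x₀ ∈ Set.Icc x₁ x₂, ∃ v ∈ Set.Icc v₁ v₂, q.1 = x₀ + v * q.2}

/-- The velocity of the soliton of the pole with index `n`: `-n₁₂` or `-n₂₃`. -/
def velocity (a b : Fin 3 → ℝ) : PoleIndex N₁ N₂ → ℝ
  | .inl _ => -speed a b 0 1
  | .inr _ => -speed a b 1 2

open Classical in
/-- Indices of the poles whose velocity lies in the open interval `(v₁, v₂)`. -/
def retained (N₁ N₂ : ℕ) (a b : Fin 3 → ℝ) (v₁ v₂ : ℝ) : Finset (PoleIndex N₁ N₂) :=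
  Finset.univ.filter fun n => velocity a b n ∈ Set.Ioo v₁ v₂

open Classical in
/-- Indices of the remaining poles. -/
def discarded (N₁ N₂ : ℕ) (a b : Fin 3 → ℝ) (v₁ v₂ : ℝ) : Finset (PoleIndex N₁ N₂) :=
  Finset.univ.filter fun n => velocity a b n ∉ Set.Ioo v₁ v₂

open Classical in
/-- `Π₁(w)`, the product of `(w - conj z_n) / (w - z_n)` over the poles of the first family
that are faster than the cone. -/
def blaschke₁ (a b : Fin 3 → ℝ) (z : PoleIndex N₁ N₂ → ℂ) (v₂ : ℝ) (w : ℂ) : ℂ :=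
  ∏ m : Fin N₁ with v₂ < velocity a b (.inl m : PoleIndex N₁ N₂),
    (w - star (z (.inl m))) / (w - z (.inl m))

open Classical in
/-- `Π₂(w)`, the same product over the second family. -/
def blaschke₂ (a b : Fin 3 → ℝ) (z : PoleIndex N₁ N₂ → ℂ) (v₂ : ℝ) (w : ℂ) : ℂ :=
  ∏ m : Fin N₂ with v₂ < velocity a b (.inr m : PoleIndex N₁ N₂),
    (w - star (z (.inr m))) / (w - z (.inr m))

/-- The norming constants `c_n(I)` of the retained poles. -/
def coneNorming (a b : Fin 3 → ℝ) (z c : PoleIndex N₁ N₂ → ℂ) (v₂ : ℝ) : PoleIndex N₁ N₂ → ℂ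
  | .inl m => c (.inl m) * blaschke₂ a b z v₂ (z (.inl m))
  | .inr m => c (.inr m) * blaschke₁ a b z v₂ (z (.inr m))

/-- `p` is the value at `(x, t)` of the soliton solution with the full modified data,
which depend on `ξ = x / t`. -/
def IsFullSolitonValue (a b : Fin 3 → ℝ) (z c : PoleIndex N₁ N₂ → ℂ) (r₁ : ℝ → ℂ)
    (x t : ℝ) (p : Matrix (Fin 3) (Fin 3) ℂ) : Prop :=
  IsSolitonValue a b Finset.univ z (modifiedNorming a b r₁ (x / t) z c) x t p

/-- `p` is the value at `(x, t)` of the `N(I)`-soliton solution, built from the retained poles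
with the modified constants. -/
def IsConeSolitonValue (a b : Fin 3 → ℝ) (z c : PoleIndex N₁ N₂ → ℂ) (r₁ : ℝ → ℂ)
    (v₁ v₂ x t : ℝ) (p : Matrix (Fin 3) (Fin 3) ℂ) : Prop :=
  IsSolitonValue a b (retained N₁ N₂ a b v₁ v₂) z
    (modifiedNorming a b r₁ (x / t) z (coneNorming a b z c v₂)) x t p

/-- `μ(I)`: the minimum of `Im z_n · min_i |v_i - v_{z_n}|` over the (nonempty) set of
discarded poles. -/
def mu (a b : Fin 3 → ℝ) (z : PoleIndex N₁ N₂ → ℂ) (v₁ v₂ : ℝ)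
    (h : (discarded N₁ N₂ a b v₁ v₂).Nonempty) : ℝ :=
  (discarded N₁ N₂ a b v₁ v₂).inf' h fun n =>
    (z n).im * min |v₁ - velocity a b n| |v₂ - velocity a b n|

/-- The two regimes `ξ > -n₁₂` and `-n₁₃ < ξ < -n₁₂` for `ξ = x / t`. -/
def InRegime (a b : Fin 3 → ℝ) (x t : ℝ) : Prop :=
  -speed a b 0 1 < x / t ∨ (-speed a b 0 2 < x / t ∧ x / t < -speed a b 0 1)

end ThreeWave

end

/-!
A reflectionless solution is determined row by row. A row is a vector of three functions which are
holomorphic off the poles, have simple poles there, and tend to a constant vector at infinity. At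
the pole `e` one column `col e` is singular, and its residue is a coupling constant `κ e` times the
value of another column, which is the singular one at the conjugate pole. The couplings at
conjugate poles are related by `κ (bar e) = -conj (κ e)`.

The whole argument rests on one identity (`IsRow.pairing_eq`). For rows `f`, `g` of two such
problems, with the same poles but different couplings `κ`, `κ'`, the pairing
`∑ j, f_j(z) conj (g_j (conj z))` has only simple poles, and the residue at `e` is `κ e - κ' e`
times a product of regular values of the two rows. Hence, by Liouville's theorem, the pairing is an
explicit rational function. It has four consequences.

* For `κ = κ'` the pairing is constant. So a row that vanishes at infinity vanishes on the real
  line, hence everywhere; the linear system for the residues is injective and solutions exist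
  (`exists_isRow`). The rows of a normalized solution are orthonormal on the real line, which
  together with `det N = 1` gives the symmetry of the problem (`eq_adjugate_conjTranspose`).
* A normalized row is bounded by `1` on the real line. As its poles are fixed, its residues and
  regular values are bounded by a constant independent of the couplings (`IsRow.exists_bound`).
* Comparing coefficients of `1 / z`, the potentials of two solutions differ by at most a constant
  times `∑ |κ - κ'|` (`IsRow.exists_lipschitz`). In particular the potential is unique, and poles
  with exponentially small couplings can be dropped.
* Poles of the first family that are faster than the cone have exponentially large couplings.
  Multiplying the first two columns by the Blaschke product of the first family and by its inverse
  exchanges the roles of the two columns at these poles and inverts their couplings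
  (`IsRow.flip`). This changes the couplings of the second family by the Blaschke factors in the
  definition of the cone data and leaves the off-diagonal potential unchanged.

Poles of the second family never have large couplings: both regimes require
`x / t > -n₁₃ > -n₂₃`, so a cone that is slower than these poles eventually leaves the regimes
(`exists_forall_not_inRegime`). If `μ(I) = 0`, the uniform bound on
the potentials already gives the claim.
-/

namespace ThreeWave

section SimplePoles

/-! ### Rational functions with simple poles -/

lemma tendsto_sub_self_nhdsNE (w : ℂ) : Tendsto (fun z : ℂ => z - w) (𝓝[≠] w) (𝓝 0) := by
  have h : Tendsto (fun z : ℂ => z - w) (𝓝 w) (𝓝 (w - w)) :=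
    (continuous_id.sub continuous_const).tendsto w
  rw [sub_self] at h
  exact h.mono_left nhdsWithin_le_nhds

lemma tendsto_star_nhdsNE (w : ℂ) : Tendsto (fun z : ℂ => star z) (𝓝[≠] w) (𝓝[≠] (star w)) := by
  refine tendsto_nhdsWithin_iff.2 ⟨(continuous_star.tendsto w).mono_left nhdsWithin_le_nhds, ?_⟩
  filter_upwards [self_mem_nhdsWithin] with z hz h
  exact hz (star_injective h)

lemma tendsto_star_cobounded :
    Tendsto (fun z : ℂ => star z) (Bornology.cobounded ℂ) (Bornology.cobounded ℂ) := by
  rw [← tendsto_norm_atTop_iff_cobounded]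
  simpa using tendsto_norm_cobounded_atTop (E := ℂ)

lemma isLittleO_sub_inv_of_tendsto {F : ℂ → ℂ} {w : ℂ}
    (h : Tendsto (fun z => (z - w) * F z) (𝓝[≠] w) (𝓝 0)) :
    (fun z => F z - F w) =o[𝓝[≠] w] fun z => (z - w)⁻¹ := by
  rw [isLittleO_iff_tendsto']
  · have h2 : Tendsto (fun z => (z - w) * F z - (z - w) * F w) (𝓝[≠] w) (𝓝 (0 - 0 * F w)) :=
      h.sub ((tendsto_sub_self_nhdsNE w).mul_const _)
    simp only [zero_mul, sub_zero] at h2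
    refine h2.congr fun z => ?_
    rw [div_inv_eq_mul]
    ring
  · filter_upwards [self_mem_nhdsWithin] with z hz h0
    exact absurd (sub_eq_zero.1 (inv_eq_zero.1 h0)) hz

lemma exists_tendsto_of_mul_tendsto_zero {F : ℂ → ℂ} {w : ℂ}
    (hd : ∀ᶠ z in 𝓝[≠] w, DifferentiableAt ℂ F z)
    (h : Tendsto (fun z => (z - w) * F z) (𝓝[≠] w) (𝓝 0)) :
    ∃ l, Tendsto F (𝓝[≠] w) (𝓝 l) :=
  ⟨_, Complex.tendsto_limUnder_of_differentiable_on_punctured_nhds_of_isLittleO hd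
    (isLittleO_sub_inv_of_tendsto h)⟩

/-- A function that is holomorphic off a finite set, at each point of which it has a vanishing
simple pole, extends to an entire function. -/
lemma exists_differentiable_eqOn_compl (P : Finset ℂ) :
    ∀ G : ℂ → ℂ, DifferentiableOn ℂ G (P : Set ℂ)ᶜ →
      (∀ w ∈ P, Tendsto (fun z => (z - w) * G z) (𝓝[≠] w) (𝓝 0)) →
      ∃ H : ℂ → ℂ, Differentiable ℂ H ∧ Set.EqOn H G (P : Set ℂ)ᶜ := by
  classical
  induction P using Finset.induction_on with
  | empty =>
    intro G hG _
    refine ⟨G, ?_, fun _ _ => rfl⟩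
    simpa [differentiableOn_univ] using hG
  | insert w P hw ih =>
    intro G hG hlim
    have hset : ((insert w P : Finset ℂ) : Set ℂ)ᶜ = (P : Set ℂ)ᶜ \ {w} := by
      ext z; simp [and_comm]
    have hnhds : (P : Set ℂ)ᶜ ∈ 𝓝 w :=
      P.finite_toSet.isClosed.isOpen_compl.mem_nhds (by simpa using hw)
    have hupd := Complex.differentiableOn_update_limUnder_of_isLittleO hnhds (hset ▸ hG)
      (isLittleO_sub_inv_of_tendsto (hlim w (Finset.mem_insert_self _ _)))
    obtain ⟨H, hH, hHeq⟩ := ih _ hupd fun u hu => by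
      refine (hlim u (Finset.mem_insert_of_mem hu)).congr' ?_
      have huw : u ≠ w := fun h => hw (h ▸ hu)
      filter_upwards [mem_nhdsWithin_of_mem_nhds (isOpen_ne.mem_nhds huw)] with z hz
      rw [Function.update_of_ne hz]
    refine ⟨H, hH, fun z hz => ?_⟩
    rw [hset] at hz
    rw [hHeq hz.1, Function.update_of_ne hz.2]

variable {E : Type*} [Fintype E]

lemma isOpen_compl_range (w : E → ℂ) : IsOpen (Set.range w)ᶜ :=
  (Set.finite_range w).isClosed.isOpen_compl

lemma eventually_notMem_range {w : E → ℂ} (hw : Function.Injective w) (e : E) :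
    ∀ᶠ z in 𝓝[≠] w e, z ∉ Set.range w := by
  have h : ∀ᶠ z in 𝓝 (w e), ∀ e' : E, e' ≠ e → z ≠ w e' := by
    rw [eventually_all]
    intro e'
    by_cases he : e' = e
    · simp [he]
    · filter_upwards [isOpen_ne.mem_nhds (fun h => he (hw h).symm : w e ≠ w e')] with z hz _
      exact hz
  filter_upwards [mem_nhdsWithin_of_mem_nhds h, self_mem_nhdsWithin] with z hz hne
  rintro ⟨e', rfl⟩
  by_cases he : e' = e
  · exact hne (by simp [he])
  · exact hz e' he rfl

lemma differentiableOn_sum_div (w : E → ℂ) (R : E → ℂ) :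
    DifferentiableOn ℂ (fun z => ∑ e, R e / (z - w e)) (Set.range w)ᶜ := by
  refine DifferentiableOn.fun_sum fun e _ => ?_
  refine (differentiableOn_const _).div (differentiableOn_id.sub_const _) fun z hz h => hz ⟨e, ?_⟩
  exact (sub_eq_zero.1 h).symm

lemma tendsto_inv_sub_cobounded (w : ℂ) :
    Tendsto (fun z : ℂ => (z - w)⁻¹) (Bornology.cobounded ℂ) (𝓝 0) :=
  tendsto_inv₀_cobounded.comp (tendsto_sub_const_cobounded w)

lemma tendsto_mul_inv_sub_cobounded (w : ℂ) :
    Tendsto (fun z : ℂ => z * (z - w)⁻¹) (Bornology.cobounded ℂ) (𝓝 1) := by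
  have h : Tendsto (fun z : ℂ => 1 + w * (z - w)⁻¹) (Bornology.cobounded ℂ) (𝓝 (1 + w * 0)) :=
    tendsto_const_nhds.add ((tendsto_inv_sub_cobounded w).const_mul w)
  rw [mul_zero, add_zero] at h
  refine h.congr' ?_
  filter_upwards [Bornology.eventually_ne_cobounded w] with z hz
  have := sub_ne_zero.2 hz
  field_simp
  ring

lemma tendsto_sum_div_cobounded (w R : E → ℂ) :
    Tendsto (fun z => ∑ e, R e / (z - w e)) (Bornology.cobounded ℂ) (𝓝 0) := by
  have : Tendsto (fun z => ∑ e, R e / (z - w e)) (Bornology.cobounded ℂ)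
      (𝓝 (∑ e : E, R e * 0)) :=
    tendsto_finsetSum _ fun e _ => (tendsto_inv_sub_cobounded (w e)).const_mul (R e)
  simpa using this

lemma tendsto_mul_sum_div_cobounded (w R : E → ℂ) :
    Tendsto (fun z => z * ∑ e, R e / (z - w e)) (Bornology.cobounded ℂ) (𝓝 (∑ e, R e)) := by
  have : Tendsto (fun z => ∑ e, R e * (z * (z - w e)⁻¹)) (Bornology.cobounded ℂ)
      (𝓝 (∑ e : E, R e * 1)) :=
    tendsto_finsetSum _ fun e _ => (tendsto_mul_inv_sub_cobounded (w e)).const_mul (R e)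
  simp only [mul_one] at this
  refine this.congr fun z => ?_
  rw [Finset.mul_sum]
  exact Finset.sum_congr rfl fun e _ => by rw [div_eq_mul_inv]; ring

lemma tendsto_mul_sum_div_nhdsNE {w : E → ℂ} (hw : Function.Injective w) (R : E → ℂ) (e : E) :
    Tendsto (fun z => (z - w e) * ∑ e', R e' / (z - w e')) (𝓝[≠] w e) (𝓝 (R e)) := by
  classical
  have : Tendsto (fun z => ∑ e', (z - w e) * (R e' / (z - w e'))) (𝓝[≠] w e)
      (𝓝 (∑ e' : E, if e' = e then R e' else 0)) := by
    refine tendsto_finsetSum _ fun e' _ => ?_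
    by_cases he : e' = e
    · subst he
      rw [if_pos rfl]
      refine tendsto_const_nhds.congr' ?_
      filter_upwards [self_mem_nhdsWithin] with z hz
      rw [mul_div_cancel₀ _ (sub_ne_zero.2 hz)]
    · rw [if_neg he]
      have h1 : w e - w e' ≠ 0 := sub_ne_zero.2 fun h => he (hw h).symm
      have h2 : ContinuousAt (fun z => R e' / (z - w e')) (w e) :=
        continuousAt_const.div (continuousAt_id.sub continuousAt_const) h1
      simpa using (tendsto_sub_self_nhdsNE (w e)).mul (h2.tendsto.mono_left nhdsWithin_le_nhds)
  simp only [Finset.sum_ite_eq', Finset.mem_univ, if_true] at this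
  simpa only [Finset.mul_sum] using this

/-- A sum of simple poles tends to its value at a node whose own coefficient vanishes; there the
singular summand `0 / 0` is `0`. -/
lemma tendsto_sum_div_nhdsNE {w : E → ℂ} (hw : Function.Injective w) {R : E → ℂ} {e : E}
    (hR : R e = 0) :
    Tendsto (fun z => ∑ e', R e' / (z - w e')) (𝓝[≠] w e) (𝓝 (∑ e', R e' / (w e - w e'))) := by
  refine tendsto_finsetSum _ fun e' _ => ?_
  by_cases he : e' = e
  · subst he
    simp [hR]
  · have h1 : w e - w e' ≠ 0 := sub_ne_zero.2 fun h => he (hw h).symm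
    have h2 : ContinuousAt (fun z => R e' / (z - w e')) (w e) :=
      continuousAt_const.div (continuousAt_id.sub continuousAt_const) h1
    exact h2.tendsto.mono_left nhdsWithin_le_nhds

/-- Liouville's theorem for functions with finitely many simple poles: such a function with a
finite limit at infinity is the sum of that limit and of its principal parts. -/
theorem eq_add_sum_div_of_simplePoles {w : E → ℂ} (hw : Function.Injective w) {F : ℂ → ℂ}
    (hd : DifferentiableOn ℂ F (Set.range w)ᶜ) {R : E → ℂ}
    (hR : ∀ e, Tendsto (fun z => (z - w e) * F z) (𝓝[≠] w e) (𝓝 (R e))) {c : ℂ}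
    (hc : Tendsto F (Bornology.cobounded ℂ) (𝓝 c)) {z : ℂ} (hz : z ∉ Set.range w) :
    F z = c + ∑ e, R e / (z - w e) := by
  classical
  have hP : ((Finset.univ.image w : Finset ℂ) : Set ℂ) = Set.range w := by simp
  obtain ⟨H, hH, hHeq⟩ := exists_differentiable_eqOn_compl (Finset.univ.image w)
    (fun z => F z - ∑ e, R e / (z - w e))
    (by rw [hP]; exact hd.sub (differentiableOn_sum_div w R)) (by
      intro u hu
      obtain ⟨e, -, rfl⟩ := Finset.mem_image.1 hu
      have := (hR e).sub (tendsto_mul_sum_div_nhdsNE hw R e)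
      rw [sub_self] at this
      exact this.congr fun z => by ring)
  rw [hP] at hHeq
  have hlim : Tendsto H (Bornology.cobounded ℂ) (𝓝 c) := by
    have h := hc.sub (tendsto_sum_div_cobounded w R)
    rw [sub_zero] at h
    refine h.congr' ?_
    have hb : (Set.range w)ᶜ ∈ Bornology.cobounded ℂ :=
      (Bornology.isBounded_def.1 (Set.finite_range w).isBounded)
    filter_upwards [hb] with z hz
    exact (hHeq hz).symm
  have := hH.apply_eq_of_tendsto_cocompact z (by rwa [← Metric.cobounded_eq_cocompact])
  rw [hHeq hz] at this
  exact sub_eq_iff_eq_add.1 this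

/-- The functions `1 / (z - w e)` are linearly independent on the unit interval. -/
lemma eq_zero_of_sum_div_eq_zero {w : E → ℂ} (hw : Function.Injective w)
    (him : ∀ e, (w e).im ≠ 0) {R : E → ℂ}
    (h : ∀ s ∈ Set.Icc (0 : ℝ) 1, ∑ e, R e / ((s : ℂ) - w e) = 0) : R = 0 := by
  have hreal : ∀ s : ℝ, (s : ℂ) ∉ Set.range w := by
    rintro s ⟨e, he⟩
    exact him e (by simp [he])
  have han : AnalyticOnNhd ℂ (fun z => ∑ e, R e / (z - w e)) (Set.range w)ᶜ :=
    (differentiableOn_sum_div w R).analyticOnNhd (isOpen_compl_range w)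
  have hconn : IsPreconnected (Set.range w)ᶜ :=
    ((Set.finite_range w).countable.isConnected_compl_of_one_lt_rank (by simp)).isPreconnected
  have hfreq : ∃ᶠ z in 𝓝[≠] (0 : ℂ), ∑ e, R e / (z - w e) = 0 := by
    have ht : Tendsto (fun n : ℕ => ((1 / ((n : ℝ) + 1) : ℝ) : ℂ)) atTop (𝓝[≠] (0 : ℂ)) := by
      refine tendsto_nhdsWithin_iff.2 ⟨?_, Eventually.of_forall fun n => ?_⟩
      · have := (Complex.continuous_ofReal.tendsto 0).comp
          (tendsto_one_div_add_atTop_nhds_zero_nat (𝕜 := ℝ))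
        rw [Complex.ofReal_zero] at this
        refine this.congr fun n => ?_
        simp
      · simp only [Set.mem_compl_iff, Set.mem_singleton_iff, Complex.ofReal_eq_zero]
        positivity
    refine ht.frequently (Frequently.of_forall fun n => h _ ⟨by positivity, ?_⟩)
    rw [div_le_one (by positivity)]
    linarith [(n.cast_nonneg : (0 : ℝ) ≤ n)]
  have hzero := han.eqOn_zero_of_preconnected_of_frequently_eq_zero hconn
    (by simpa using hreal 0) hfreq
  funext e
  refine tendsto_nhds_unique (tendsto_mul_sum_div_nhdsNE hw R e)
    (tendsto_const_nhds.congr' ?_)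
  filter_upwards [eventually_notMem_range hw e] with z hz
  rw [show ∑ e', R e' / (z - w e') = 0 from hzero hz, mul_zero]
  rfl

/-- The coefficients of a sum of simple poles off the real axis are controlled by its supremum
on the real line, since all norms on a finite-dimensional space are equivalent. -/
theorem exists_coeff_bound_of_sum_div {w : E → ℂ} (hw : Function.Injective w)
    (him : ∀ e, (w e).im ≠ 0) :
    ∃ C : ℝ, 0 ≤ C ∧ ∀ (R : E → ℂ) (M : ℝ), 0 ≤ M →
      (∀ s : ℝ, ‖∑ e, R e / ((s : ℂ) - w e)‖ ≤ M) → ∀ e, ‖R e‖ ≤ C * M := by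
  have hreal : ∀ (s : ℝ) (e : E), (s : ℂ) - w e ≠ 0 := fun s e h =>
    him e (by simp [← sub_eq_zero.1 h])
  let T : (E → ℂ) →ₗ[ℂ] C(Set.Icc (0 : ℝ) 1, ℂ) :=
    { toFun := fun R => ⟨fun s => ∑ e, R e / (((s : ℝ) : ℂ) - w e), by
        refine continuous_finsetSum _ fun e _ => continuous_const.div ?_ fun s => hreal s e
        fun_prop⟩
      map_add' := fun R R' => by
        ext s; simp [add_div, Finset.sum_add_distrib]
      map_smul' := fun a R => by
        ext s; simp [mul_div_assoc, Finset.mul_sum] }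
  have hker : LinearMap.ker T = ⊥ := by
    refine LinearMap.ker_eq_bot'.2 fun R hR => eq_zero_of_sum_div_eq_zero hw him fun s hs => ?_
    exact DFunLike.congr_fun hR (⟨s, hs⟩ : Set.Icc (0 : ℝ) 1)
  obtain ⟨K, -, hK⟩ := T.exists_antilipschitzWith hker
  refine ⟨K, K.2, fun R M hM hb e => ?_⟩
  have h1 : ‖T R‖ ≤ M := (ContinuousMap.norm_le _ hM).2 fun s => hb s
  calc ‖R e‖ ≤ ‖R‖ := norm_le_pi_norm R e
    _ ≤ K * ‖T R‖ := by simpa using hK.le_mul_dist R 0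
    _ ≤ K * M := by gcongr

end SimplePoles

section Rows

/-! ### Rows of reflectionless solutions -/

/-- The positions and the column pattern of the poles of a reflectionless problem: at `z n` the
column `tgt n` has a pole whose residue is proportional to the column `src n`, and at `conj (z n)`
the two columns are exchanged. -/
structure PoleConfig (ι : Type*) where
  z : ι → ℂ
  src : ι → Fin 3
  tgt : ι → Fin 3
  inj : Function.Injective z
  im_pos : ∀ n, 0 < (z n).im
  src_ne_tgt : ∀ n, src n ≠ tgt n

variable {ι : Type*}

namespace PoleConfig

/-- The poles: `(n, true)` stands for `z n` and `(n, false)` for its conjugate. -/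
def node (D : PoleConfig ι) : ι × Bool → ℂ
  | (n, true) => D.z n
  | (n, false) => star (D.z n)

/-- The column that is singular at a pole. -/
def col (D : PoleConfig ι) : ι × Bool → Fin 3
  | (n, true) => D.tgt n
  | (n, false) => D.src n

/-- The conjugate pole. -/
def bar : ι × Bool → ι × Bool
  | (n, s) => (n, !s)

/-- The coupling constants at the poles, extended to the conjugate poles by the symmetry of the
problem. -/
def coupling (K : ι → ℂ) : ι × Bool → ℂ
  | (n, true) => K n
  | (n, false) => -star (K n)

@[simp] lemma bar_bar (e : ι × Bool) : bar (bar e) = e := by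
  obtain ⟨n, s⟩ := e; simp [bar]

lemma coupling_bar (K : ι → ℂ) (e : ι × Bool) :
    coupling K (bar e) = -star (coupling K e) := by
  obtain ⟨n, _ | _⟩ := e <;> simp [bar, coupling]

lemma norm_coupling_sub (K K' : ι → ℂ) (e : ι × Bool) :
    ‖coupling K e - coupling K' e‖ = ‖K e.1 - K' e.1‖ := by
  obtain ⟨n, _ | _⟩ := e
  · rw [coupling, coupling, neg_sub_neg, ← star_sub, norm_star, norm_sub_rev]
  · rfl

variable (D : PoleConfig ι)

lemma node_bar (e : ι × Bool) : D.node (bar e) = star (D.node e) := by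
  obtain ⟨n, _ | _⟩ := e <;> simp [bar, node]

lemma col_bar_ne (e : ι × Bool) : D.col (bar e) ≠ D.col e := by
  obtain ⟨n, _ | _⟩ := e
  · exact (D.src_ne_tgt n).symm
  · exact D.src_ne_tgt n

lemma node_im_ne (e : ι × Bool) : (D.node e).im ≠ 0 := by
  obtain ⟨n, _ | _⟩ := e
  · simpa [node] using (D.im_pos n).ne'
  · exact (D.im_pos n).ne'

lemma node_injective : Function.Injective D.node := by
  rintro ⟨n, _ | _⟩ ⟨m, _ | _⟩ h
  · rw [D.inj (star_injective h)]
  · have h1 := congrArg Complex.im h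
    simp only [node, Complex.star_def, Complex.conj_im] at h1
    linarith [D.im_pos n, D.im_pos m]
  · have h1 := congrArg Complex.im h
    simp only [node, Complex.star_def, Complex.conj_im] at h1
    linarith [D.im_pos n, D.im_pos m]
  · rw [D.inj h]

lemma star_mem_range_node {w : ℂ} : star w ∈ Set.range D.node ↔ w ∈ Set.range D.node := by
  constructor
  · rintro ⟨e, he⟩
    exact ⟨bar e, by rw [node_bar, he, star_star]⟩
  · rintro ⟨e, rfl⟩
    exact ⟨bar e, D.node_bar e⟩

lemma ofReal_notMem_range_node (s : ℝ) : (s : ℂ) ∉ Set.range D.node := by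
  rintro ⟨e, he⟩
  exact D.node_im_ne e (by simp [he])

end PoleConfig

open PoleConfig

/-- `f` is a row of a solution of the reflectionless problem with poles `D`, coupling constants
`K` and value `d` at infinity. The vector `φ e` collects the limits at the pole `e` of the entries
that are regular there. -/
structure IsRow (D : PoleConfig ι) (K : ι → ℂ) (d : Fin 3 → ℂ) (f : ℂ → Fin 3 → ℂ)
    (φ : ι × Bool → Fin 3 → ℂ) : Prop where
  diff : ∀ j, DifferentiableOn ℂ (fun z => f z j) (Set.range D.node)ᶜ
  lim : ∀ j, Tendsto (fun z => f z j) (Bornology.cobounded ℂ) (𝓝 (d j))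
  regular : ∀ e, ∀ j ≠ D.col e, Tendsto (fun z => f z j) (𝓝[≠] D.node e) (𝓝 (φ e j))
  pole : ∀ e, Tendsto (fun z => (z - D.node e) * f z (D.col e)) (𝓝[≠] D.node e)
    (𝓝 (coupling K e * φ e (D.col (bar e))))

namespace IsRow

variable {D : PoleConfig ι} {K K' : ι → ℂ} {d d' : Fin 3 → ℂ} {f g : ℂ → Fin 3 → ℂ}
  {φ ψ : ι × Bool → Fin 3 → ℂ}

lemma tendsto_mul (hf : IsRow D K d f φ) (e : ι × Bool) (j : Fin 3) :
    Tendsto (fun z => (z - D.node e) * f z j) (𝓝[≠] D.node e)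
      (𝓝 (if D.col e = j then coupling K e * φ e (D.col (bar e)) else 0)) := by
  split_ifs with h
  · exact h ▸ hf.pole e
  · simpa using (tendsto_sub_self_nhdsNE _).mul (hf.regular e j (Ne.symm h))

lemma regular_conj (hg : IsRow D K' d' g ψ) (e : ι × Bool) {j : Fin 3} (hj : j ≠ D.col (bar e)) :
    Tendsto (fun z => star (g (star z) j)) (𝓝[≠] D.node e) (𝓝 (star (ψ (bar e) j))) := by
  have h := hg.regular (bar e) j hj
  rw [node_bar] at h
  exact (h.comp (tendsto_star_nhdsNE _)).star

lemma pole_conj (hg : IsRow D K' d' g ψ) (e : ι × Bool) :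
    Tendsto (fun z => (z - D.node e) * star (g (star z) (D.col (bar e)))) (𝓝[≠] D.node e)
      (𝓝 (-coupling K' e * star (ψ (bar e) (D.col e)))) := by
  have h := hg.pole (bar e)
  rw [node_bar] at h
  have h2 := (h.comp (tendsto_star_nhdsNE _)).star
  simp only [coupling_bar, bar_bar, star_mul', star_neg, star_star] at h2
  refine h2.congr fun z => ?_
  simp

/-- The two singular terms in the pairing of two rows combine to a residue that is proportional to
the difference of the coupling constants. -/
lemma tendsto_mul_pairing (hf : IsRow D K d f φ) (hg : IsRow D K' d' g ψ) (e : ι × Bool) :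
    Tendsto (fun z => (z - D.node e) * ∑ j, f z j * star (g (star z) j)) (𝓝[≠] D.node e)
      (𝓝 ((coupling K e - coupling K' e) *
        (φ e (D.col (bar e)) * star (ψ (bar e) (D.col e))))) := by
  set p := φ e (D.col (bar e)) * star (ψ (bar e) (D.col e)) with hp
  have key : Tendsto (fun z => ∑ j, (z - D.node e) * (f z j * star (g (star z) j)))
      (𝓝[≠] D.node e) (𝓝 (∑ j, ((if D.col e = j then coupling K e * p else 0) +
        if D.col (bar e) = j then -coupling K' e * p else 0))) := by
    refine tendsto_finsetSum _ fun j _ => ?_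
    by_cases h1 : D.col e = j
    · have h2 : D.col (bar e) ≠ j := h1 ▸ D.col_bar_ne e
      rw [if_pos h1, if_neg h2, add_zero]
      subst h1
      have := (hf.pole e).mul (hg.regular_conj e h2.symm)
      rw [mul_assoc] at this
      exact this.congr fun z => by ring
    · rw [if_neg h1, zero_add]
      by_cases h2 : D.col (bar e) = j
      · rw [if_pos h2]
        subst h2
        have := (hf.regular e _ (Ne.symm h1)).mul (hg.pole_conj e)
        rw [show φ e (D.col (bar e)) * (-coupling K' e * star (ψ (bar e) (D.col e))) =
          -coupling K' e * p by rw [hp]; ring] at this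
        exact this.congr fun z => by ring
      · rw [if_neg h2]
        simpa using (tendsto_sub_self_nhdsNE (D.node e)).mul
          ((hf.regular e j (Ne.symm h1)).mul (hg.regular_conj e (Ne.symm h2)))
  rw [Finset.sum_add_distrib, Finset.sum_ite_eq, Finset.sum_ite_eq] at key
  simp only [Finset.mem_univ, if_true] at key
  rw [sub_mul, sub_eq_add_neg, ← neg_mul]
  simpa only [Finset.mul_sum] using key

variable [Fintype ι]

lemma differentiableOn_conj (hg : IsRow D K' d' g ψ) (j : Fin 3) :
    DifferentiableOn ℂ (fun z => star (g (star z) j)) (Set.range D.node)ᶜ := by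
  intro z hz
  have h : DifferentiableAt ℂ (fun z => g z j) (star z) :=
    (hg.diff j).differentiableAt ((isOpen_compl_range _).mem_nhds
      (mt D.star_mem_range_node.1 hz))
  have h2 := h.conj_conj
  simp only [Complex.star_def, Complex.conj_conj] at h2
  exact h2.differentiableWithinAt

/-- The pairing `∑ j, f_j(z) conj (g_j (conj z))` of two rows is a rational function whose residues
are governed by the differences of the coupling constants. -/
theorem pairing_eq (hf : IsRow D K d f φ) (hg : IsRow D K' d' g ψ) {z : ℂ}
    (hz : z ∉ Set.range D.node) :
    ∑ j, f z j * star (g (star z) j) = ∑ j, d j * star (d' j) +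
      ∑ e, (coupling K e - coupling K' e) *
        (φ e (D.col (bar e)) * star (ψ (bar e) (D.col e))) / (z - D.node e) :=
  eq_add_sum_div_of_simplePoles D.node_injective
    (F := fun z => ∑ j, f z j * star (g (star z) j))
    (DifferentiableOn.fun_sum fun j _ => (hf.diff j).mul (hg.differentiableOn_conj j))
    (hf.tendsto_mul_pairing hg)
    (tendsto_finsetSum _ fun j _ => (hf.lim j).mul
      (((hg.lim j).comp tendsto_star_cobounded).star)) hz

theorem pairing_self_eq (hf : IsRow D K d f φ) (hg : IsRow D K d' g ψ) {z : ℂ}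
    (hz : z ∉ Set.range D.node) :
    ∑ j, f z j * star (g (star z) j) = ∑ j, d j * star (d' j) := by
  rw [hf.pairing_eq hg hz]
  simp

/-- The residue of the entry `j` of a row at the pole `e`. -/
def residue (D : PoleConfig ι) (K : ι → ℂ) (φ : ι × Bool → Fin 3 → ℂ) (j : Fin 3)
    (e : ι × Bool) : ℂ :=
  if D.col e = j then coupling K e * φ e (D.col (bar e)) else 0

lemma apply_eq (hf : IsRow D K d f φ) {z : ℂ} (hz : z ∉ Set.range D.node) (j : Fin 3) :
    f z j = d j + ∑ e, residue D K φ j e / (z - D.node e) :=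
  eq_add_sum_div_of_simplePoles D.node_injective (F := fun z => f z j) (hf.diff j)
    (fun e => hf.tendsto_mul e j) (hf.lim j) hz

lemma tendsto_mul_sub (hf : IsRow D K d f φ) (j : Fin 3) :
    Tendsto (fun z => z * (f z j - d j)) (Bornology.cobounded ℂ)
      (𝓝 (∑ e, residue D K φ j e)) := by
  refine (tendsto_mul_sum_div_cobounded D.node _).congr' ?_
  have hb : (Set.range D.node)ᶜ ∈ Bornology.cobounded ℂ :=
    (Bornology.isBounded_def.1 (Set.finite_range _).isBounded)
  filter_upwards [hb] with z hz
  rw [hf.apply_eq hz j, add_sub_cancel_left]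

/-- On the real line a row has constant Euclidean norm. -/
lemma norm_apply_ofReal_sq (hf : IsRow D K d f φ) (s : ℝ) :
    ∑ j, ‖f s j‖ ^ 2 = ∑ j, ‖d j‖ ^ 2 := by
  have h := hf.pairing_self_eq hf (D.ofReal_notMem_range_node s)
  simp only [Complex.star_def, Complex.conj_ofReal, Complex.mul_conj, Complex.normSq_eq_norm_sq]
    at h
  exact_mod_cast h

lemma norm_sum_residue_le (hf : IsRow D K d f φ) {M : ℝ} (hM : 0 ≤ M)
    (hd : ∑ j, ‖d j‖ ^ 2 ≤ M ^ 2) (j : Fin 3) (s : ℝ) :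
    ‖∑ e, residue D K φ j e / ((s : ℂ) - D.node e)‖ ≤ 2 * M := by
  have h1 : ‖f s j‖ ≤ M := by
    refine abs_le_of_sq_le_sq' ?_ hM |>.2
    refine le_trans ?_ ((hf.norm_apply_ofReal_sq s).trans_le hd)
    exact Finset.single_le_sum (f := fun j => ‖f s j‖ ^ 2) (fun _ _ => by positivity)
      (Finset.mem_univ j)
  have h2 : ‖d j‖ ≤ M := by
    refine abs_le_of_sq_le_sq' ?_ hM |>.2
    refine le_trans ?_ hd
    exact Finset.single_le_sum (f := fun j => ‖d j‖ ^ 2) (fun _ _ => by positivity)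
      (Finset.mem_univ j)
  have h3 : ∑ e, residue D K φ j e / ((s : ℂ) - D.node e) = f s j - d j := by
    rw [hf.apply_eq (D.ofReal_notMem_range_node s) j, add_sub_cancel_left]
  rw [h3]
  exact (norm_sub_le _ _).trans (by linarith)

/-- The regular value at a pole in terms of the residues at the other poles. -/
lemma value_eq (hf : IsRow D K d f φ) (e : ι × Bool) {j : Fin 3} (hj : j ≠ D.col e) :
    φ e j = d j + ∑ e', residue D K φ j e' / (D.node e - D.node e') := by
  refine tendsto_nhds_unique (hf.regular e j hj) ?_
  have h := (tendsto_sum_div_nhdsNE D.node_injective (R := residue D K φ j) (e := e)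
    (if_neg hj.symm)).const_add (d j)
  refine h.congr' ?_
  filter_upwards [eventually_notMem_range D.node_injective e] with z hz
  exact (hf.apply_eq hz j).symm

lemma residue_eq_zero (hf : IsRow D K 0 f φ) (j : Fin 3) : residue D K φ j = 0 := by
  refine eq_zero_of_sum_div_eq_zero D.node_injective D.node_im_ne fun s _ => ?_
  have := hf.norm_sum_residue_le le_rfl (by simp) j s
  simpa using this

/-- Residues and regular values of a normalized row are bounded by a constant that depends only on
the poles, not on the coupling constants. -/
theorem exists_bound (D : PoleConfig ι) :
    ∃ C : ℝ, 0 ≤ C ∧ ∀ (K : ι → ℂ) (i : Fin 3) (f : ℂ → Fin 3 → ℂ) (φ : ι × Bool → Fin 3 → ℂ),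
      IsRow D K (Pi.single i 1) f φ → (∀ j e, ‖residue D K φ j e‖ ≤ C) ∧
        ∀ e, ∀ j ≠ D.col e, ‖φ e j‖ ≤ C := by
  obtain ⟨C, hC0, hC⟩ := exists_coeff_bound_of_sum_div D.node_injective D.node_im_ne
  have hone : ∀ i j : Fin 3, ‖(Pi.single i 1 : Fin 3 → ℂ) j‖ ≤ 1 := fun i j => by
    rw [Pi.single_apply]; split_ifs <;> simp
  refine ⟨max (C * 2) (1 + ∑ e, ∑ e', C * 2 / ‖D.node e - D.node e'‖), by positivity,
    fun K i f φ hf => ?_⟩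
  have hd : ∑ j, ‖(Pi.single i 1 : Fin 3 → ℂ) j‖ ^ 2 ≤ 1 ^ 2 := by
    fin_cases i <;> simp [Fin.sum_univ_three]
  have hres : ∀ j e, ‖residue D K φ j e‖ ≤ C * 2 := fun j e =>
    hC _ 2 zero_le_two (fun s => by simpa using hf.norm_sum_residue_le zero_le_one hd j s) e
  refine ⟨fun j e => (hres j e).trans (le_max_left _ _), fun e j hj => le_trans ?_
    (le_max_right _ _)⟩
  rw [hf.value_eq e hj]
  refine (norm_add_le _ _).trans (add_le_add (hone i j) ?_)
  calc ‖∑ e', residue D K φ j e' / (D.node e - D.node e')‖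
      ≤ ∑ e', C * 2 / ‖D.node e - D.node e'‖ := by
        refine norm_sum_le_of_le _ fun e' _ => ?_
        rw [norm_div]
        gcongr
        exact hres j e'
    _ ≤ ∑ e, ∑ e', C * 2 / ‖D.node e - D.node e'‖ :=
        Finset.single_le_sum (f := fun e => ∑ e', C * 2 / ‖D.node e - D.node e'‖)
          (fun e _ => by positivity) (Finset.mem_univ e)

/-- The coefficient of `1 / z` in the pairing identity. -/
theorem sum_residue_add_star_sum_residue {i k : Fin 3} (hf : IsRow D K (Pi.single i 1) f φ)
    (hg : IsRow D K' (Pi.single k 1) g ψ) :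
    ∑ e, residue D K φ k e + star (∑ e, residue D K' ψ i e) =
      ∑ e, (coupling K e - coupling K' e) *
        (φ e (D.col (bar e)) * star (ψ (bar e) (D.col e))) := by
  set d : Fin 3 → ℂ := Pi.single i 1 with hd
  set d' : Fin 3 → ℂ := Pi.single k 1 with hd'
  have hF := fun j => hf.tendsto_mul_sub j
  have hG := fun j => ((hg.tendsto_mul_sub j).comp tendsto_star_cobounded).star
  have h1 : Tendsto (fun z => ∑ j, (z * (f z j - d j) * star (g (star z) j) +
      d j * star (star z * (g (star z) j - d' j)))) (Bornology.cobounded ℂ)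
      (𝓝 (∑ j, ((∑ e, residue D K φ j e) * star (d' j) +
        d j * star (∑ e, residue D K' ψ j e)))) := by
    refine tendsto_finsetSum _ fun j _ => ((hF j).mul ?_).add ((hG j).const_mul (d j))
    exact ((hg.lim j).comp tendsto_star_cobounded).star
  have h2 : ∑ j, ((∑ e, residue D K φ j e) * star (d' j) +
      d j * star (∑ e, residue D K' ψ j e)) =
      ∑ e, residue D K φ k e + star (∑ e, residue D K' ψ i e) := by
    rw [Finset.sum_add_distrib]
    congr 1
    · rw [Finset.sum_eq_single k (fun j _ hj => by simp [hd', hj]) (by simp)]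
      simp [hd']
    · rw [Finset.sum_eq_single i (fun j _ hj => by simp [hd, hj]) (by simp)]
      simp [hd]
  rw [h2] at h1
  refine tendsto_nhds_unique h1 ((tendsto_mul_sum_div_cobounded D.node _).congr' ?_)
  have hb : (Set.range D.node)ᶜ ∈ Bornology.cobounded ℂ :=
    (Bornology.isBounded_def.1 (Set.finite_range _).isBounded)
  filter_upwards [hb] with z hz
  have h3 := hf.pairing_eq hg hz
  rw [← sub_eq_iff_eq_add', ← Finset.sum_sub_distrib] at h3
  rw [← h3, Finset.mul_sum]
  refine Finset.sum_congr rfl fun j _ => ?_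
  simp only [star_mul', star_star, star_sub]
  ring

/-- The `1 / z` coefficient of a normalized solution depends Lipschitz-continuously on the
coupling constants, with a constant that depends only on the poles. -/
theorem exists_lipschitz (D : PoleConfig ι) :
    ∃ C : ℝ, 0 ≤ C ∧ ∀ (K K' : ι → ℂ) (N M : ℂ → Fin 3 → Fin 3 → ℂ)
      (φ ψ : Fin 3 → ι × Bool → Fin 3 → ℂ),
      (∀ i, IsRow D K (Pi.single i 1) (fun z => N z i) (φ i)) →
      (∀ i, IsRow D K' (Pi.single i 1) (fun z => M z i) (ψ i)) → ∀ i j,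
      ‖∑ e, residue D K (φ i) j e - ∑ e, residue D K' (ψ i) j e‖ ≤
        C * ∑ n, ‖K n - K' n‖ := by
  obtain ⟨C, hC0, hC⟩ := exists_bound D
  refine ⟨2 * (C * C), by positivity, fun K K' N M φ ψ hN hM i j => ?_⟩
  have h1 := (hN i).sum_residue_add_star_sum_residue (hM j)
  have h2 := (hM i).sum_residue_add_star_sum_residue (hM j)
  simp only [sub_self, zero_mul, Finset.sum_const_zero] at h2
  have h3 : ∑ e, residue D K (φ i) j e - ∑ e, residue D K' (ψ i) j e =
      ∑ e, (coupling K e - coupling K' e) *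
        (φ i e (D.col (bar e)) * star (ψ j (bar e) (D.col e))) := by
    rw [← h1, ← sub_zero (_ + star _), ← h2]; ring
  rw [h3]
  have h4 : ∀ e : ι × Bool, ‖(coupling K e - coupling K' e) *
      (φ i e (D.col (bar e)) * star (ψ j (bar e) (D.col e)))‖ ≤ C * C * ‖K e.1 - K' e.1‖ := by
    intro e
    rw [norm_mul, norm_mul, norm_star, norm_coupling_sub, mul_comm]
    have hφ := (hC K i _ _ (hN i)).2 e _ (D.col_bar_ne e)
    have hψ := (hC K' j _ _ (hM j)).2 (bar e) (D.col e) (D.col_bar_ne e).symm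
    gcongr
  refine (norm_sum_le_of_le _ fun e _ => h4 e).trans_eq ?_
  rw [Fintype.sum_prod_type, Finset.mul_sum]
  refine Finset.sum_congr rfl fun n _ => ?_
  simp only [Fintype.sum_bool]
  ring

theorem exists_sum_residue_bound (D : PoleConfig ι) :
    ∃ C : ℝ, 0 ≤ C ∧ ∀ (K : ι → ℂ) (i j : Fin 3) (f : ℂ → Fin 3 → ℂ)
      (φ : ι × Bool → Fin 3 → ℂ), IsRow D K (Pi.single i 1) f φ →
      ‖∑ e, residue D K φ j e‖ ≤ C := by
  obtain ⟨C, hC0, hC⟩ := exists_bound D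
  refine ⟨∑ _e : ι × Bool, C, by positivity, fun K i j f φ hf => ?_⟩
  exact norm_sum_le_of_le _ fun e _ => (hC K i f φ hf).1 j e

end IsRow

end Rows

section RowExistence

open PoleConfig

/-! ### Existence of rows -/

section Existence

variable {ι : Type*} [Fintype ι]

/-- Residues that solve the linear system of the problem define a row. -/
lemma isRow_of_system (D : PoleConfig ι) (K : ι → ℂ) (d : Fin 3 → ℂ) (c : ι × Bool → ℂ)
    (φ : ι × Bool → Fin 3 → ℂ)
    (hφ : ∀ e j, φ e j = d j +
      ∑ e', (if D.col e' = j then c e' else 0) / (D.node e - D.node e'))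
    (hc : ∀ e, c e = coupling K e * φ e (D.col (bar e))) :
    IsRow D K d (fun z j => d j + ∑ e, (if D.col e = j then c e else 0) / (z - D.node e)) φ where
  diff j := (differentiableOn_const _).add (differentiableOn_sum_div _ _)
  lim j := by
    simpa using (tendsto_sum_div_cobounded D.node
      (fun e => if D.col e = j then c e else 0)).const_add (d j)
  regular e j hj := by
    rw [hφ]
    exact (tendsto_sum_div_nhdsNE D.node_injective
      (R := fun e' => if D.col e' = j then c e' else 0) (if_neg hj.symm)).const_add _
  pole e := by
    rw [← hc]
    have h1 := (tendsto_sub_self_nhdsNE (D.node e)).mul_const (d (D.col e))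
    have h2 := tendsto_mul_sum_div_nhdsNE D.node_injective
      (fun e' => if D.col e' = D.col e then c e' else 0) e
    simp only [if_true] at h2
    have h3 := h1.add h2
    rw [zero_mul, zero_add] at h3
    exact h3.congr fun z => by ring

/-- Rows exist for arbitrary coupling constants and values at infinity: the linear system for the
residues is injective because a row that vanishes at infinity vanishes. -/
theorem exists_isRow (D : PoleConfig ι) (K : ι → ℂ) (d : Fin 3 → ℂ) :
    ∃ f φ, IsRow D K d f φ := by
  let φ : (Fin 3 → ℂ) → (ι × Bool → ℂ) → ι × Bool → Fin 3 → ℂ := fun d c e j =>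
    d j + ∑ e', (if D.col e' = j then c e' else 0) / (D.node e - D.node e')
  let T : (ι × Bool → ℂ) →ₗ[ℂ] (ι × Bool → ℂ) :=
    { toFun := fun c e => c e - coupling K e * φ 0 c e (D.col (bar e))
      map_add' := fun c c' => by
        ext e
        have h : φ 0 (c + c') e (D.col (bar e)) =
            φ 0 c e (D.col (bar e)) + φ 0 c' e (D.col (bar e)) := by
          simp only [φ, Pi.zero_apply, zero_add, ← Finset.sum_add_distrib, ← add_div]
          refine Finset.sum_congr rfl fun e' _ => ?_
          split_ifs <;> simp
        simp only [h, Pi.add_apply]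
        ring
      map_smul' := fun r c => by
        ext e
        have h : φ 0 (r • c) e (D.col (bar e)) = r * φ 0 c e (D.col (bar e)) := by
          simp only [φ, Pi.zero_apply, zero_add, Finset.mul_sum, ← mul_div_assoc]
          refine Finset.sum_congr rfl fun e' _ => ?_
          split_ifs <;> simp
        simp only [h, Pi.smul_apply, smul_eq_mul, RingHom.id_apply]
        ring }
  have hinj : Function.Injective T := by
    refine (injective_iff_map_eq_zero T).2 fun c hc => ?_
    have hsys : ∀ e, c e = coupling K e * φ 0 c e (D.col (bar e)) := fun e =>
      sub_eq_zero.1 (congrFun hc e)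
    have hrow := isRow_of_system D K 0 c (φ 0 c) (fun _ _ => rfl) hsys
    funext e
    have h := congrFun (hrow.residue_eq_zero (D.col e)) e
    rw [IsRow.residue, if_pos rfl, ← hsys] at h
    exact h
  obtain ⟨c, hc⟩ := (LinearMap.injective_iff_surjective.1 hinj)
    fun e => coupling K e * d (D.col (bar e))
  refine ⟨_, φ d c, isRow_of_system D K d c (φ d c) (fun _ _ => rfl) fun e => ?_⟩
  have h : c e - coupling K e * φ 0 c e (D.col (bar e)) = coupling K e * d (D.col (bar e)) :=
    congrFun hc e
  rw [sub_eq_iff_eq_add] at h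
  rw [h]
  simp only [φ, Pi.zero_apply]
  ring

end Existence

/-! ### Matrix solutions -/

section MatrixSolutions

variable {ι : Type*} [Fintype ι] {D : PoleConfig ι} {K : ι → ℂ}
  {N : ℂ → Matrix (Fin 3) (Fin 3) ℂ} {φ : Fin 3 → ι × Bool → Fin 3 → ℂ}

lemma mul_conjTranspose_eq_one (hN : ∀ i, IsRow D K (Pi.single i 1) (fun z => N z i) (φ i))
    {w : ℂ} (hw : w ∉ Set.range D.node) : N w * (N (star w)).conjTranspose = 1 := by
  ext i k
  rw [Matrix.mul_apply]
  simp only [Matrix.conjTranspose_apply]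
  rw [(hN i).pairing_self_eq (hN k) hw, Matrix.one_apply]
  simp only [Pi.single_apply]
  split_ifs with h
  · subst h; simp
  · simp [Ne.symm h]

/-- The determinant is entire because the residue of the singular column at each pole is
proportional to another column. -/
lemma det_eq_one (hN : ∀ i, IsRow D K (Pi.single i 1) (fun z => N z i) (φ i))
    {w : ℂ} (hw : w ∉ Set.range D.node) : (N w).det = 1 := by
  have h := eq_add_sum_div_of_simplePoles D.node_injective (F := fun z => (N z).det)
    (R := fun _ => 0) (c := 1) ?_ (fun e => ?_) ?_ hw
  · simpa using h
  · simp only [Matrix.det_fin_three]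
    have h := fun i j => (hN i).diff j
    fun_prop (disch := assumption)
  · set Φ : Matrix (Fin 3) (Fin 3) ℂ := fun i j => φ i e j with hΦ
    have h1 : Tendsto (fun z => ((N z).updateCol (D.col e)
        ((z - D.node e) • fun i => N z i (D.col e)))) (𝓝[≠] D.node e)
        (𝓝 (Φ.updateCol (D.col e) (coupling K e • fun i => Φ i (D.col (bar e))))) := by
      refine tendsto_pi_nhds.2 fun i => tendsto_pi_nhds.2 fun j => ?_
      by_cases hj : j = D.col e
      · subst hj
        simpa [Matrix.updateCol_self] using (hN i).pole e
      · simpa only [Matrix.updateCol_ne hj] using (hN i).regular e j hj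
    have h2 : (Φ.updateCol (D.col e) (coupling K e • fun i => Φ i (D.col (bar e)))).det = 0 := by
      rw [Matrix.det_updateCol_smul, Matrix.det_zero_of_column_eq (D.col_bar_ne e), mul_zero]
      intro i
      rw [Matrix.updateCol_self, Matrix.updateCol_ne (D.col_bar_ne e)]
    have h3 := ((continuous_id.matrix_det).tendsto _).comp h1
    simp only [id_eq] at h3
    rw [h2] at h3
    refine h3.congr fun z => ?_
    simp only [Function.comp_apply]
    rw [Matrix.det_updateCol_smul]
    congr 2
    exact Matrix.updateCol_eq_self _ _
  · have h1 : Tendsto N (Bornology.cobounded ℂ) (𝓝 1) := by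
      refine tendsto_pi_nhds.2 fun i => tendsto_pi_nhds.2 fun j => ?_
      have := (hN i).lim j
      rwa [Pi.single_apply, show (if j = i then (1 : ℂ) else 0) =
        (1 : Matrix (Fin 3) (Fin 3) ℂ) i j by rw [Matrix.one_apply]; simp [eq_comm]] at this
    have h3 := ((continuous_id.matrix_det).tendsto _).comp h1
    simpa [Function.comp_def] using h3

lemma eq_adjugate_conjTranspose (hN : ∀ i, IsRow D K (Pi.single i 1) (fun z => N z i) (φ i))
    {w : ℂ} (hw : w ∉ Set.range D.node) :
    N w = (N (star w)).adjugate.conjTranspose := by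
  have hw' : star w ∉ Set.range D.node := mt D.star_mem_range_node.1 hw
  have h1 := mul_conjTranspose_eq_one hN hw
  have h2 : (N (star w)).conjTranspose * (N (star w)).adjugate.conjTranspose = 1 := by
    rw [← Matrix.conjTranspose_mul, Matrix.adjugate_mul, det_eq_one hN hw', one_smul,
      Matrix.conjTranspose_one]
  exact left_inv_eq_right_inv h1 h2

end MatrixSolutions

end RowExistence

section SolitonRows

open PoleConfig

/-! ### Soliton solutions in terms of rows -/

variable {N₁ N₂ : ℕ}

/-- The column entering the residue at `z_n`. -/
def srcCol : PoleIndex N₁ N₂ → Fin 3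
  | .inl _ => 0
  | .inr _ => 1

/-- The column with a pole at `z_n`. -/
def tgtCol : PoleIndex N₁ N₂ → Fin 3
  | .inl _ => 1
  | .inr _ => 2

lemma srcCol_ne_tgtCol (n : PoleIndex N₁ N₂) : srcCol n ≠ tgtCol n := by
  cases n <;> simp [srcCol, tgtCol]

/-- The norming constants together with the exponential factor of the evolution. -/
noncomputable def evolvedNorming (a b : Fin 3 → ℝ) (x t : ℝ) (z k : PoleIndex N₁ N₂ → ℂ)
    (n : PoleIndex N₁ N₂) : ℂ :=
  k n * Complex.exp (Complex.I * z n * (phase a b (srcCol n) (tgtCol n) x t : ℂ))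

lemma residueMatrix_eq (a b : Fin 3 → ℝ) (x t : ℝ) (z k : PoleIndex N₁ N₂ → ℂ)
    (n : PoleIndex N₁ N₂) :
    residueMatrix a b x t n (z n) (k n) =
      Matrix.single (srcCol n) (tgtCol n) (evolvedNorming a b x t z k n) := by
  cases n <;> rfl

lemma residueMatrixConj_eq (a b : Fin 3 → ℝ) (x t : ℝ) (z k : PoleIndex N₁ N₂ → ℂ)
    (n : PoleIndex N₁ N₂) :
    residueMatrixConj a b x t n (z n) (k n) =
      Matrix.single (tgtCol n) (srcCol n) (-star (evolvedNorming a b x t z k n)) := by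
  have h : ∀ (k w : ℂ) (r : ℝ), -(star k) * Complex.exp (-Complex.I * star w * (r : ℂ)) =
      -star (k * Complex.exp (Complex.I * w * (r : ℂ))) := by
    intro k w r
    simp only [star_mul', Complex.star_def, ← Complex.exp_conj, map_mul, Complex.conj_I,
      Complex.conj_ofReal, neg_mul]
  cases n <;> simp only [residueMatrixConj, h] <;> rfl

/-- The pole configuration of a subfamily of the discrete spectrum. -/
@[simps]
def solitonConfig {ι : Type*} {z : PoleIndex N₁ N₂ → ℂ} (hz : Function.Injective z)
    (hz_im : ∀ n, 0 < (z n).im) (f : ι → PoleIndex N₁ N₂) (hf : Function.Injective f) :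
    PoleConfig ι where
  z n := z (f n)
  src n := srcCol (f n)
  tgt n := tgtCol (f n)
  inj := hz.comp hf
  im_pos _ := hz_im _
  src_ne_tgt _ := srcCol_ne_tgtCol _

lemma mul_single_apply (A : Matrix (Fin 3) (Fin 3) ℂ) (s u : Fin 3) (κ : ℂ) (i j : Fin 3) :
    (A * Matrix.single s u κ) i j = if j = u then κ * A i s else 0 := by
  by_cases h : j = u
  · subst h; simp [mul_comm]
  · rw [Matrix.mul_single_apply_of_ne _ _ _ _ _ h, if_neg h]

/-- A residue condition with a nilpotent matrix unit says that the column `u` has a simple pole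
whose residue is a multiple of the limit of the column `s`, while the other columns are regular. -/
lemma HasResidueCondition.exists_limits {N : ℂ → Matrix (Fin 3) (Fin 3) ℂ} {w : ℂ} {s u : Fin 3}
    {κ : ℂ} (h : HasResidueCondition N w (Matrix.single s u κ)) (hsu : s ≠ u)
    (hd : ∀ i j, ∀ᶠ z in 𝓝[≠] w, DifferentiableAt ℂ (fun z => N z i j) z) :
    ∃ Φ : Fin 3 → Fin 3 → ℂ, (∀ i, ∀ j ≠ u, Tendsto (fun z => N z i j) (𝓝[≠] w) (𝓝 (Φ i j))) ∧
      ∀ i, Tendsto (fun z => (z - w) * N z i u) (𝓝[≠] w) (𝓝 (κ * Φ i s)) := by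
  obtain ⟨R, hR, hR'⟩ := h
  have h1 : ∀ i j, Tendsto (fun z => (z - w) * N z i j) (𝓝[≠] w) (𝓝 (R i j)) := fun i j =>
    tendsto_pi_nhds.1 (tendsto_pi_nhds.1 hR i) j
  have h2 : ∀ i j, Tendsto (fun z => if j = u then κ * N z i s else 0) (𝓝[≠] w) (𝓝 (R i j)) :=
    fun i j => (tendsto_pi_nhds.1 (tendsto_pi_nhds.1 hR' i) j).congr fun z =>
      mul_single_apply _ _ _ _ _ _
  have h3 : ∀ i, ∀ j ≠ u, R i j = 0 := fun i j hj =>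
    ((tendsto_const_nhds_iff (l := 𝓝[≠] w)).1 (by simpa only [if_neg hj] using h2 i j)).symm
  have h4 : ∀ i, ∀ j ≠ u, ∃ l, Tendsto (fun z => N z i j) (𝓝[≠] w) (𝓝 l) := fun i j hj =>
    exists_tendsto_of_mul_tendsto_zero (hd i j) (h3 i j hj ▸ h1 i j)
  choose! Φ hΦ using h4
  refine ⟨Φ, hΦ, fun i => ?_⟩
  have h5 : R i u = κ * Φ i s :=
    tendsto_nhds_unique (by simpa only [if_true] using h2 i u) ((hΦ i s hsu).const_mul κ)
  exact h5 ▸ h1 i u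

lemma finite_poleSet (S : Finset (PoleIndex N₁ N₂)) (z : PoleIndex N₁ N₂ → ℂ) :
    (poleSet S z).Finite := by
  have : poleSet S z ⊆ (z '' S) ∪ ((fun n => star (z n)) '' S) := by
    rintro w ⟨n, hn, rfl | rfl⟩
    · exact Or.inl ⟨n, hn, rfl⟩
    · exact Or.inr ⟨n, hn, rfl⟩
  exact ((S.finite_toSet.image _).union (S.finite_toSet.image _)).subset this

lemma IsReflectionlessSolution.differentiableAt {a b : Fin 3 → ℝ} {S : Finset (PoleIndex N₁ N₂)}
    {z k : PoleIndex N₁ N₂ → ℂ} {x t : ℝ} {N : ℂ → Matrix (Fin 3) (Fin 3) ℂ}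
    (hN : IsReflectionlessSolution a b S z k x t N) {w : ℂ} (hw : w ∉ poleSet S z) (i j : Fin 3) :
    DifferentiableAt ℂ (fun w => N w i j) w :=
  (hN.analytic i j).differentiableAt ((finite_poleSet S z).isClosed.isOpen_compl.mem_nhds hw)

/-- The rows of a solution of the reflectionless problem with poles `S` are rows for every
configuration with the same poles and the same columns on `S`, the couplings outside `S` being
zero. -/
theorem IsReflectionlessSolution.exists_isRow {a b : Fin 3 → ℝ} {S : Finset (PoleIndex N₁ N₂)}
    {z k : PoleIndex N₁ N₂ → ℂ} {x t : ℝ} {N : ℂ → Matrix (Fin 3) (Fin 3) ℂ}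
    (hN : IsReflectionlessSolution a b S z k x t N) (D : PoleConfig (PoleIndex N₁ N₂))
    (hDz : D.z = z) (hsrc : ∀ n ∈ S, D.src n = srcCol n) (htgt : ∀ n ∈ S, D.tgt n = tgtCol n)
    {K : PoleIndex N₁ N₂ → ℂ} (hK : ∀ n ∈ S, K n = evolvedNorming a b x t z k n)
    (hK0 : ∀ n ∉ S, K n = 0) :
    ∃ φ : Fin 3 → PoleIndex N₁ N₂ × Bool → Fin 3 → ℂ, ∀ i, IsRow D K (Pi.single i 1) (fun w => N w i) (φ i) := by
  have hdiff : ∀ w ∉ poleSet S z, ∀ i j, DifferentiableAt ℂ (fun w => N w i j) w :=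
    fun w hw i j => hN.differentiableAt hw i j
  have hsub : poleSet S z ⊆ Set.range D.node := by
    rintro w ⟨n, -, rfl | rfl⟩
    · exact ⟨(n, true), by rw [← hDz]; rfl⟩
    · exact ⟨(n, false), by rw [← hDz]; rfl⟩
  have hev : ∀ e i j, ∀ᶠ z in 𝓝[≠] D.node e, DifferentiableAt ℂ (fun z => N z i j) z := by
    intro e i j
    filter_upwards [eventually_notMem_range D.node_injective e] with w hw
    exact hdiff w (fun h => hw (hsub h)) i j
  have key : ∀ e, ∃ Φ : Fin 3 → Fin 3 → ℂ,
      (∀ i, ∀ j ≠ D.col e, Tendsto (fun z => N z i j) (𝓝[≠] D.node e) (𝓝 (Φ i j))) ∧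
      ∀ i, Tendsto (fun z => (z - D.node e) * N z i (D.col e)) (𝓝[≠] D.node e)
        (𝓝 (coupling K e * Φ i (D.col (bar e)))) := by
    rintro ⟨n, s⟩
    by_cases hn : n ∈ S
    · cases s
      · have h := hN.residue_conj n hn
        rw [residueMatrixConj_eq, ← hK n hn, ← hsrc n hn, ← htgt n hn] at h
        subst hDz
        exact h.exists_limits (D.src_ne_tgt n).symm (hev (n, false))
      · have h := hN.residue n hn
        rw [residueMatrix_eq, ← hK n hn, ← hsrc n hn, ← htgt n hn] at h
        subst hDz
        exact h.exists_limits (D.src_ne_tgt n) (hev (n, true))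
    · have hw : D.node (n, s) ∉ poleSet S z := by
        rintro ⟨m, hm, h⟩
        have h' : ∃ u, D.node (n, s) = D.node (m, u) := by
          subst hDz
          rcases h with h | h
          · exact ⟨true, h⟩
          · exact ⟨false, h⟩
        obtain ⟨u, hu⟩ := h'
        have := congrArg Prod.fst (D.node_injective hu)
        exact hn ((show n = m from this) ▸ hm)
      have hlim : ∀ i j, Tendsto (fun z => N z i j) (𝓝[≠] D.node (n, s))
          (𝓝 (N (D.node (n, s)) i j)) := fun i j =>
        (hdiff _ hw i j).continuousAt.tendsto.mono_left nhdsWithin_le_nhds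
      refine ⟨N (D.node (n, s)), fun i j _ => hlim i j, fun i => ?_⟩
      have hc : coupling K (n, s) = 0 := by
        cases s <;> simp [coupling, hK0 n hn]
      simpa [hc] using (tendsto_sub_self_nhdsNE (D.node (n, s))).mul (hlim i (D.col (n, s)))
  choose Φ hΦ hΦ' using key
  refine ⟨fun i e j => Φ e i j, fun i => ⟨fun j => ?_, fun j => ?_, fun e j hj => hΦ e i j hj,
    fun e => hΦ' e i⟩⟩
  · exact (hN.analytic i j).mono (Set.compl_subset_compl.2 hsub)
  · have h := (hN.normalization i j).trans_tendsto tendsto_inv₀_cobounded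
    have h2 := h.add_const ((1 : Matrix (Fin 3) (Fin 3) ℂ) i j)
    simp only [sub_add_cancel, zero_add] at h2
    rwa [show (Pi.single i 1 : Fin 3 → ℂ) j = (1 : Matrix (Fin 3) (Fin 3) ℂ) i j by
      rw [Pi.single_apply, Matrix.one_apply]; simp [eq_comm]]

/-- The potential read off from a row; on the diagonal both sides vanish. -/
lemma IsRow.tendsto_potential {ι : Type*} [Fintype ι] {D : PoleConfig ι} {K : ι → ℂ}
    {f : ℂ → Fin 3 → ℂ} {φ : ι × Bool → Fin 3 → ℂ} (a : Fin 3 → ℝ) {i : Fin 3}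
    (hf : IsRow D K (Pi.single i 1) f φ) (j : Fin 3) :
    Tendsto (fun w => -Complex.I * ((a i - a j : ℝ) : ℂ) * (w * f w j)) (Bornology.cobounded ℂ)
      (𝓝 (-Complex.I * ((a i - a j : ℝ) : ℂ) * ∑ e, IsRow.residue D K φ j e)) := by
  by_cases h : j = i
  · subst h
    simp
  · have := hf.tendsto_mul_sub j
    simp only [Pi.single_eq_of_ne h, sub_zero] at this
    exact this.const_mul _

theorem IsSolitonValue.exists_rows {a b : Fin 3 → ℝ} {S : Finset (PoleIndex N₁ N₂)}
    {z k : PoleIndex N₁ N₂ → ℂ} {x t : ℝ} {p : Matrix (Fin 3) (Fin 3) ℂ}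
    (hp : IsSolitonValue a b S z k x t p) (D : PoleConfig (PoleIndex N₁ N₂))
    (hDz : D.z = z) (hsrc : ∀ n ∈ S, D.src n = srcCol n) (htgt : ∀ n ∈ S, D.tgt n = tgtCol n)
    {K : PoleIndex N₁ N₂ → ℂ} (hK : ∀ n ∈ S, K n = evolvedNorming a b x t z k n)
    (hK0 : ∀ n ∉ S, K n = 0) :
    ∃ (N : ℂ → Fin 3 → Fin 3 → ℂ) (φ : Fin 3 → PoleIndex N₁ N₂ × Bool → Fin 3 → ℂ),
      (∀ i, IsRow D K (Pi.single i 1) (fun w => N w i) (φ i)) ∧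
      ∀ i j, p i j = -Complex.I * ((a i - a j : ℝ) : ℂ) * ∑ e, IsRow.residue D K (φ i) j e := by
  obtain ⟨N, hN, hlim⟩ := hp
  obtain ⟨φ, hφ⟩ := hN.exists_isRow D hDz hsrc htgt hK hK0
  exact ⟨N, φ, hφ, fun i j => tendsto_nhds_unique (hlim i j) ((hφ i).tendsto_potential a j)⟩

theorem IsSolitonValue.unique {a b : Fin 3 → ℝ} {S : Finset (PoleIndex N₁ N₂)}
    {z k : PoleIndex N₁ N₂ → ℂ} (hz : Function.Injective z) (hz_im : ∀ n, 0 < (z n).im) {x t : ℝ}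
    {p q : Matrix (Fin 3) (Fin 3) ℂ} (hp : IsSolitonValue a b S z k x t p)
    (hq : IsSolitonValue a b S z k x t q) : p = q := by
  classical
  let K := fun n => if n ∈ S then evolvedNorming a b x t z k n else 0
  have hK : ∀ n ∈ S, K n = evolvedNorming a b x t z k n := fun n hn => if_pos hn
  have hK0 : ∀ n ∉ S, K n = 0 := fun n hn => if_neg hn
  let D := solitonConfig hz hz_im id Function.injective_id
  obtain ⟨N, φ, hφ, hp'⟩ := hp.exists_rows D rfl (fun _ _ => rfl) (fun _ _ => rfl) hK hK0
  obtain ⟨M, ψ, hψ, hq'⟩ := hq.exists_rows D rfl (fun _ _ => rfl) (fun _ _ => rfl) hK hK0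
  obtain ⟨C, -, hC⟩ := IsRow.exists_lipschitz D
  ext i j
  have h := hC K K N M φ ψ hφ hψ i j
  simp only [sub_self, norm_zero, Finset.sum_const_zero, mul_zero, norm_le_zero_iff] at h
  rw [hp', hq', sub_eq_zero.1 h]

/-- Conversely, normalized rows for the configuration with poles `S` form a solution of the
reflectionless problem. -/
lemma isReflectionlessSolution_of_rows {a b : Fin 3 → ℝ} {S : Finset (PoleIndex N₁ N₂)}
    {z k : PoleIndex N₁ N₂ → ℂ} (hz : Function.Injective z) (hz_im : ∀ n, 0 < (z n).im) {x t : ℝ}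
    {N : ℂ → Matrix (Fin 3) (Fin 3) ℂ} {φ : Fin 3 → {n // n ∈ S} × Bool → Fin 3 → ℂ}
    (hN : ∀ i, IsRow (solitonConfig hz hz_im ((↑) : {n // n ∈ S} → _) Subtype.val_injective)
      (fun n => evolvedNorming a b x t z k n) (Pi.single i 1) (fun w => N w i) (φ i)) :
    IsReflectionlessSolution a b S z k x t N := by
  set D := solitonConfig hz hz_im ((↑) : {n // n ∈ S} → _) Subtype.val_injective with hD
  have hrange : Set.range D.node = poleSet S z := by
    ext w
    constructor
    · rintro ⟨⟨n, _ | _⟩, rfl⟩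
      · exact ⟨n, n.2, Or.inr rfl⟩
      · exact ⟨n, n.2, Or.inl rfl⟩
    · rintro ⟨n, hn, rfl | rfl⟩
      · exact ⟨(⟨n, hn⟩, true), rfl⟩
      · exact ⟨(⟨n, hn⟩, false), rfl⟩
  have hres : ∀ e, HasResidueCondition N (D.node e) (Matrix.single (D.col (bar e)) (D.col e)
      (coupling (fun n : {n // n ∈ S} => evolvedNorming a b x t z k n) e)) := by
    intro e
    refine ⟨fun i j => if j = D.col e then
      coupling (fun n : {n // n ∈ S} => evolvedNorming a b x t z k n) e *
        φ i e (D.col (bar e)) else 0, ?_, ?_⟩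
    · refine tendsto_pi_nhds.2 fun i => tendsto_pi_nhds.2 fun j => ?_
      simpa [eq_comm] using (hN i).tendsto_mul e j
    · refine tendsto_pi_nhds.2 fun i => tendsto_pi_nhds.2 fun j => ?_
      simp only [mul_single_apply]
      split_ifs with h
      · exact ((hN i).regular e _ (D.col_bar_ne e)).const_mul _
      · exact tendsto_const_nhds
  refine ⟨fun i j => hrange ▸ (hN i).diff j, fun w hw => ?_, fun i j => ?_, fun n hn => ?_,
    fun n hn => ?_⟩
  · exact eq_adjugate_conjTranspose hN (hrange ▸ hw)
  · have h := ((hN i).tendsto_mul_sub j).isBigO_one ℂ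
    have h2 := (isBigO_refl (fun w : ℂ => w⁻¹) (Bornology.cobounded ℂ)).mul h
    simp only [mul_one] at h2
    refine h2.congr' ?_ EventuallyEq.rfl
    filter_upwards [Bornology.eventually_ne_cobounded (0 : ℂ)] with w hw
    rw [inv_mul_cancel_left₀ hw, Pi.single_apply, Matrix.one_apply]
    simp [eq_comm]
  · rw [residueMatrix_eq]
    exact hres (⟨n, hn⟩, true)
  · rw [residueMatrixConj_eq]
    exact hres (⟨n, hn⟩, false)

theorem existsUnique_isSolitonValue (a b : Fin 3 → ℝ) (S : Finset (PoleIndex N₁ N₂))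
    {z : PoleIndex N₁ N₂ → ℂ} (hz : Function.Injective z) (hz_im : ∀ n, 0 < (z n).im)
    (k : PoleIndex N₁ N₂ → ℂ) (x t : ℝ) : ∃! p, IsSolitonValue a b S z k x t p := by
  choose f φ hf using fun i : Fin 3 =>
    exists_isRow (solitonConfig hz hz_im ((↑) : {n // n ∈ S} → _) Subtype.val_injective)
      (fun n => evolvedNorming a b x t z k n) (Pi.single i 1)
  refine ⟨_, ⟨fun w i => f i w, isReflectionlessSolution_of_rows hz hz_im hf, fun i j =>
    (hf i).tendsto_potential a j⟩, fun q hq => ?_⟩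
  exact hq.unique hz hz_im ⟨fun w i => f i w, isReflectionlessSolution_of_rows hz hz_im hf,
    fun i j => (hf i).tendsto_potential a j⟩

end SolitonRows

section Flip

open PoleConfig

/-! ### Blaschke products and the exchange of growing couplings -/

section Blaschke

variable {κ : Type*} [Fintype κ]

/-- The product of the factors `(w - conj ζ_m) / (w - ζ_m)`. -/
noncomputable def blaschkeProd (ζ : κ → ℂ) (w : ℂ) : ℂ := ∏ m, (w - star (ζ m)) / (w - ζ m)

open Classical in
/-- The residue at `ζ_m` of the Blaschke product. -/
noncomputable def blaschkeResidue (ζ : κ → ℂ) (m : κ) : ℂ :=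
  (ζ m - star (ζ m)) * ∏ l ∈ Finset.univ.erase m, (ζ m - star (ζ l)) / (ζ m - ζ l)

variable {ζ : κ → ℂ}

lemma blaschkeProd_ne_zero {w : ℂ} (h : ∀ m, w ≠ ζ m) (h' : ∀ m, w ≠ star (ζ m)) :
    blaschkeProd ζ w ≠ 0 :=
  Finset.prod_ne_zero_iff.2 fun m _ =>
    div_ne_zero (sub_ne_zero.2 (h' m)) (sub_ne_zero.2 (h m))

lemma differentiableAt_blaschkeProd {w : ℂ} (h : ∀ m, w ≠ ζ m) :
    DifferentiableAt ℂ (blaschkeProd ζ) w :=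
  DifferentiableAt.fun_finsetProd fun m _ =>
    (differentiableAt_id.sub_const _).div (differentiableAt_id.sub_const _)
      (sub_ne_zero.2 (h m))

lemma tendsto_blaschkeProd_cobounded :
    Tendsto (blaschkeProd ζ) (Bornology.cobounded ℂ) (𝓝 1) := by
  have h : Tendsto (fun w => ∏ m, (1 + (ζ m - star (ζ m)) * (w - ζ m)⁻¹))
      (Bornology.cobounded ℂ) (𝓝 (∏ m, (1 + (ζ m - star (ζ m)) * 0))) :=
    tendsto_finsetProd _ fun m _ =>
      ((tendsto_inv_sub_cobounded (ζ m)).const_mul _).const_add 1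
  simp only [mul_zero, add_zero, Finset.prod_const_one] at h
  refine h.congr' ?_
  have hne : ∀ᶠ w in Bornology.cobounded ℂ, ∀ m, w ≠ ζ m :=
    eventually_all.2 fun m => Bornology.eventually_ne_cobounded _
  filter_upwards [hne] with w hw
  refine Finset.prod_congr rfl fun m _ => ?_
  have := sub_ne_zero.2 (hw m)
  field_simp
  ring

lemma inv_blaschkeProd_eq (w : ℂ) : (blaschkeProd ζ w)⁻¹ = star (blaschkeProd ζ (star w)) := by
  simp only [blaschkeProd, Complex.star_def, map_prod, map_div₀, map_sub, Complex.conj_conj,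
    ← Finset.prod_inv_distrib, inv_div]

lemma blaschkeResidue_ne_zero (hζ : Function.Injective ζ) (him : ∀ m, 0 < (ζ m).im) (m : κ) :
    blaschkeResidue ζ m ≠ 0 := by
  classical
  have hne : ∀ m l, ζ m - star (ζ l) ≠ 0 := fun m l h => by
    have := congrArg Complex.im h
    simp only [Complex.sub_im, Complex.star_def, Complex.conj_im, Complex.zero_im] at this
    linarith [him m, him l]
  refine mul_ne_zero (hne m m) (Finset.prod_ne_zero_iff.2 fun l hl => div_ne_zero (hne m l) ?_)
  exact sub_ne_zero.2 fun h => (Finset.ne_of_mem_erase hl) (hζ h).symm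

lemma tendsto_mul_blaschkeProd (hζ : Function.Injective ζ) (m : κ) :
    Tendsto (fun w => (w - ζ m) * blaschkeProd ζ w) (𝓝[≠] ζ m) (𝓝 (blaschkeResidue ζ m)) := by
  classical
  have hcont : ContinuousAt (fun w => (w - star (ζ m)) *
      ∏ l ∈ Finset.univ.erase m, (w - star (ζ l)) / (w - ζ l)) (ζ m) := by
    refine (continuousAt_id.sub continuousAt_const).mul (tendsto_finsetProd _ fun l hl => ?_)
    exact (continuousAt_id.sub continuousAt_const).div (continuousAt_id.sub continuousAt_const)
      (sub_ne_zero.2 fun h => (Finset.ne_of_mem_erase hl) (hζ h).symm)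
  have h : blaschkeResidue ζ m = (ζ m - star (ζ m)) *
      ∏ l ∈ Finset.univ.erase m, (ζ m - star (ζ l)) / (ζ m - ζ l) := by
    unfold blaschkeResidue
    congr!
  rw [h]
  refine (hcont.tendsto.mono_left nhdsWithin_le_nhds).congr' ?_
  filter_upwards [self_mem_nhdsWithin] with w hw
  have : w - ζ m ≠ 0 := sub_ne_zero.2 hw
  rw [blaschkeProd, ← Finset.mul_prod_erase _ _ (Finset.mem_univ m)]
  field_simp

lemma tendsto_mul_inv_blaschkeProd (hζ : Function.Injective ζ) (m : κ) :
    Tendsto (fun w => (w - star (ζ m)) * (blaschkeProd ζ w)⁻¹) (𝓝[≠] star (ζ m))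
      (𝓝 (star (blaschkeResidue ζ m))) := by
  have h := tendsto_mul_blaschkeProd hζ m
  have h2 := tendsto_star_nhdsNE (star (ζ m))
  rw [star_star] at h2
  refine (h.comp h2).star.congr fun w => ?_
  simp only [Function.comp_apply, star_mul', star_sub, star_star, inv_blaschkeProd_eq]

end Blaschke

variable {N₁ N₂ : ℕ}

/-- The full pole configuration with the two columns of each pole of the first family
exchanged. -/
@[simps]
def flippedConfig {z : PoleIndex N₁ N₂ → ℂ} (hz : Function.Injective z)
    (hz_im : ∀ n, 0 < (z n).im) : PoleConfig (PoleIndex N₁ N₂) where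
  z := z
  src
    | .inl _ => 1
    | .inr _ => 1
  tgt
    | .inl _ => 0
    | .inr _ => 2
  inj := hz
  im_pos := hz_im
  src_ne_tgt n := by cases n <;> simp

/-- The Blaschke product of the first family. -/
noncomputable def firstBlaschke (z : PoleIndex N₁ N₂ → ℂ) : ℂ → ℂ :=
  blaschkeProd fun m : Fin N₁ => z (.inl m)

/-- The couplings after the exchange: those of the first family are inverted. -/
noncomputable def flippedCoupling (z K : PoleIndex N₁ N₂ → ℂ) : PoleIndex N₁ N₂ → ℂ
  | .inl m => blaschkeResidue (fun m : Fin N₁ => z (.inl m)) m ^ 2 / K (.inl m)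
  | .inr m => K (.inr m) * firstBlaschke z (z (.inr m))

/-- Multiplication of the first column by the Blaschke product of the first family, and of the
second column by its inverse, moves the poles of the first family from the second column to the
first and inverts their couplings. -/
theorem IsRow.flip {z : PoleIndex N₁ N₂ → ℂ} (hz : Function.Injective z)
    (hz_im : ∀ n, 0 < (z n).im) {K : PoleIndex N₁ N₂ → ℂ} (hK : ∀ m : Fin N₁, K (.inl m) ≠ 0)
    {d : Fin 3 → ℂ} {f : ℂ → Fin 3 → ℂ} {φ : PoleIndex N₁ N₂ × Bool → Fin 3 → ℂ}
    (hf : IsRow (solitonConfig hz hz_im id Function.injective_id) K d f φ) :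
    ∃ φ', IsRow (flippedConfig hz hz_im) (flippedCoupling z K) d
      (fun w => ![f w 0 * firstBlaschke z w, f w 1 * (firstBlaschke z w)⁻¹, f w 2]) φ' := by
  set D := solitonConfig hz hz_im id Function.injective_id with hD
  set D' := flippedConfig hz hz_im with hD'
  set B := firstBlaschke z with hB
  set ζ : Fin N₁ → ℂ := fun m => z (.inl m) with hζdef
  have hζ : Function.Injective ζ := fun m l h => Sum.inl_injective (hz h)
  have hζim : ∀ m, 0 < (ζ m).im := fun m => hz_im _
  have hnode : ∀ e, D'.node e = D.node e := by rintro ⟨n, _ | _⟩ <;> rfl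
  have hrange : Set.range D'.node = Set.range D.node := by rw [funext hnode]
  have hoff : ∀ w ∉ Set.range D.node, (∀ m, w ≠ ζ m) ∧ ∀ m, w ≠ star (ζ m) := fun w hw =>
    ⟨fun m h => hw ⟨(.inl m, true), h.symm⟩, fun m h => hw ⟨(.inl m, false), h.symm⟩⟩
  have hBdiff : DifferentiableOn ℂ B (Set.range D.node)ᶜ := fun w hw =>
    (differentiableAt_blaschkeProd (hoff w hw).1).differentiableWithinAt
  have hB0 : ∀ w ∈ (Set.range D.node)ᶜ, B w ≠ 0 := fun w hw =>
    blaschkeProd_ne_zero (hoff w hw).1 (hoff w hw).2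
  have hBlim : Tendsto B (Bornology.cobounded ℂ) (𝓝 1) := tendsto_blaschkeProd_cobounded
  have hBlim' : Tendsto (fun w => (B w)⁻¹) (Bornology.cobounded ℂ) (𝓝 1) := by
    simpa using hBlim.inv₀ one_ne_zero
  -- the poles of the second family are neither zeros nor poles of the Blaschke product
  have hsecond : ∀ (m : Fin N₂) (s : Bool), (∀ l, D.node (.inr m, s) ≠ ζ l) ∧
      ∀ l, D.node (.inr m, s) ≠ star (ζ l) := by
    refine fun m s => ⟨fun l h => ?_, fun l h => ?_⟩
    · have h' : D.node (.inr m, s) = D.node (.inl l, true) := h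
      simpa using D.node_injective h'
    · have h' : D.node (.inr m, s) = D.node (.inl l, false) := h
      simpa using D.node_injective h'
  have hB2 : ∀ (m : Fin N₂) (s : Bool),
      Tendsto B (𝓝[≠] D.node (.inr m, s)) (𝓝 (B (D.node (.inr m, s)))) := fun m s =>
    (differentiableAt_blaschkeProd (hsecond m s).1).continuousAt.tendsto.mono_left
      nhdsWithin_le_nhds
  have hB2ne : ∀ (m : Fin N₂) (s : Bool), B (D.node (.inr m, s)) ≠ 0 := fun m s =>
    blaschkeProd_ne_zero (hsecond m s).1 (hsecond m s).2
  have key : ∀ e, ∃ Φ : Fin 3 → ℂ,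
      (∀ j ≠ D'.col e, Tendsto (fun w => ![f w 0 * B w, f w 1 * (B w)⁻¹, f w 2] j)
        (𝓝[≠] D.node e) (𝓝 (Φ j))) ∧
      Tendsto (fun w => (w - D.node e) * ![f w 0 * B w, f w 1 * (B w)⁻¹, f w 2] (D'.col e))
        (𝓝[≠] D.node e) (𝓝 (coupling (flippedCoupling z K) e * Φ (D'.col (bar e)))) := by
    rintro ⟨m | m, _ | _⟩
    · -- `conj z_m` in the first family: the pole moves from column `0` to column `1`
      set e : PoleIndex N₁ N₂ × Bool := (.inl m, false) with he
      have hb := blaschkeResidue_ne_zero hζ hζim m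
      set β := blaschkeResidue ζ m with hβ
      have hBe : Tendsto (fun w => (w - D.node e) * (B w)⁻¹) (𝓝[≠] D.node e) (𝓝 (star β)) :=
        tendsto_mul_inv_blaschkeProd hζ m
      have hpole : Tendsto (fun w => (w - D.node e) * f w 0) (𝓝[≠] D.node e)
        (𝓝 (-star (K (.inl m)) * φ e 1)) := hf.pole e
      have hr1 : Tendsto (fun w => f w 1) (𝓝[≠] D.node e) (𝓝 (φ e 1)) :=
        hf.regular e 1 (by simp [he, hD, col, srcCol])
      have hr2 : Tendsto (fun w => f w 2) (𝓝[≠] D.node e) (𝓝 (φ e 2)) :=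
        hf.regular e 2 (by simp [he, hD, col, srcCol])
      refine ⟨![-star (K (.inl m)) * φ e 1 * (star β)⁻¹, 0, φ e 2], fun j hj => ?_, ?_⟩
      · fin_cases j
        · refine (hpole.mul (hBe.inv₀ (star_ne_zero.2 hb))).congr' ?_
          filter_upwards [self_mem_nhdsWithin] with w hw
          have : w - D.node e ≠ 0 := sub_ne_zero.2 hw
          simp only [Fin.zero_eta, Matrix.cons_val_zero, mul_inv, inv_inv]
          field_simp
        · exact absurd rfl hj
        · exact hr2
      · have h := hr1.mul hBe
        have hval : φ e 1 * star β = -star (β ^ 2 / K (.inl m)) *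
            (-star (K (.inl m)) * φ e 1 * (star β)⁻¹) := by
          have h1 : star (K (.inl m)) ≠ 0 := star_ne_zero.2 (hK m)
          have h2 : star β ≠ 0 := star_ne_zero.2 hb
          rw [star_div₀, star_pow]
          field_simp
        rw [hval] at h
        refine h.congr fun w => ?_
        simp only [he, hD', col, flippedConfig, Matrix.cons_val_one, Matrix.cons_val_zero]
        ring
    · -- `z_m` in the first family: the pole moves from column `1` to column `0`
      set e : PoleIndex N₁ N₂ × Bool := (.inl m, true) with he
      have hb := blaschkeResidue_ne_zero hζ hζim m
      set β := blaschkeResidue ζ m with hβ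
      have hBe : Tendsto (fun w => (w - D.node e) * B w) (𝓝[≠] D.node e) (𝓝 β) :=
        tendsto_mul_blaschkeProd hζ m
      have hpole : Tendsto (fun w => (w - D.node e) * f w 1) (𝓝[≠] D.node e)
        (𝓝 (K (.inl m) * φ e 0)) := hf.pole e
      have hr0 : Tendsto (fun w => f w 0) (𝓝[≠] D.node e) (𝓝 (φ e 0)) :=
        hf.regular e 0 (by simp [he, hD, col, tgtCol])
      have hr2 : Tendsto (fun w => f w 2) (𝓝[≠] D.node e) (𝓝 (φ e 2)) :=
        hf.regular e 2 (by simp [he, hD, col, tgtCol])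
      refine ⟨![0, K (.inl m) * φ e 0 * β⁻¹, φ e 2], fun j hj => ?_, ?_⟩
      · fin_cases j
        · exact absurd rfl hj
        · refine (hpole.mul (hBe.inv₀ hb)).congr' ?_
          filter_upwards [self_mem_nhdsWithin] with w hw
          have : w - D.node e ≠ 0 := sub_ne_zero.2 hw
          simp only [Fin.mk_one, Matrix.cons_val_one, Matrix.cons_val_zero, mul_inv]
          field_simp
        · exact hr2
      · have h := hr0.mul hBe
        have hval : φ e 0 * β = β ^ 2 / K (.inl m) * (K (.inl m) * φ e 0 * β⁻¹) := by
          have h1 := hK m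
          field_simp
        rw [hval] at h
        refine h.congr fun w => ?_
        simp only [he, hD', col, flippedConfig, Matrix.cons_val_zero]
        ring
    · -- `conj z_m` in the second family
      set e : PoleIndex N₁ N₂ × Bool := (.inr m, false) with he
      have hpole : Tendsto (fun w => (w - D.node e) * f w 1) (𝓝[≠] D.node e)
        (𝓝 (-star (K (.inr m)) * φ e 2)) := hf.pole e
      have hr0 : Tendsto (fun w => f w 0) (𝓝[≠] D.node e) (𝓝 (φ e 0)) :=
        hf.regular e 0 (by simp [he, hD, col, srcCol])
      have hr2 : Tendsto (fun w => f w 2) (𝓝[≠] D.node e) (𝓝 (φ e 2)) :=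
        hf.regular e 2 (by simp [he, hD, col, srcCol])
      refine ⟨![φ e 0 * B (D.node e), 0, φ e 2], fun j hj => ?_, ?_⟩
      · fin_cases j
        · exact hr0.mul (hB2 m false)
        · exact absurd rfl hj
        · exact hr2
      · have h := hpole.mul ((hB2 m false).inv₀ (hB2ne m false))
        have hval : -star (K (.inr m)) * φ e 2 * (B (D.node e))⁻¹ =
            -star (K (.inr m) * B (z (.inr m))) * φ e 2 := by
          have h1 : (B (D.node e))⁻¹ = star (B (z (.inr m))) := by
            rw [hB, firstBlaschke, inv_blaschkeProd_eq]
            simp [he, hD, node]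
          rw [h1, star_mul']
          ring
        rw [hval] at h
        refine h.congr fun w => ?_
        simp only [he, hD', col, flippedConfig, Matrix.cons_val_one, Matrix.cons_val_zero]
        ring
    · -- `z_m` in the second family
      set e : PoleIndex N₁ N₂ × Bool := (.inr m, true) with he
      have hpole : Tendsto (fun w => (w - D.node e) * f w 2) (𝓝[≠] D.node e)
        (𝓝 (K (.inr m) * φ e 1)) := hf.pole e
      have hr0 : Tendsto (fun w => f w 0) (𝓝[≠] D.node e) (𝓝 (φ e 0)) :=
        hf.regular e 0 (by simp [he, hD, col, tgtCol])
      have hr1 : Tendsto (fun w => f w 1) (𝓝[≠] D.node e) (𝓝 (φ e 1)) :=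
        hf.regular e 1 (by simp [he, hD, col, tgtCol])
      refine ⟨![φ e 0 * B (D.node e), φ e 1 * (B (D.node e))⁻¹, 0], fun j hj => ?_, ?_⟩
      · fin_cases j
        · exact hr0.mul (hB2 m true)
        · exact hr1.mul ((hB2 m true).inv₀ (hB2ne m true))
        · exact absurd rfl hj
      · have hval : K (.inr m) * φ e 1 =
            K (.inr m) * B (z (.inr m)) * (φ e 1 * (B (D.node e))⁻¹) := by
          have h1 : B (z (.inr m)) ≠ 0 := hB2ne m true
          change _ = K (.inr m) * B (z (.inr m)) * (φ e 1 * (B (z (.inr m)))⁻¹)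
          field_simp
        rw [hval] at hpole
        exact hpole
  choose Φ hΦ hΦ' using key
  refine ⟨Φ, ⟨fun j => ?_, fun j => ?_, fun e j hj => ?_, fun e => ?_⟩⟩
  · rw [hrange]
    fin_cases j
    · exact (hf.diff 0).mul hBdiff
    · exact (hf.diff 1).mul (hBdiff.inv hB0)
    · exact hf.diff 2
  · fin_cases j
    · simpa using (hf.lim 0).mul hBlim
    · simpa using (hf.lim 1).mul hBlim'
    · exact hf.lim 2
  · rw [hnode]
    exact hΦ e j hj
  · rw [hnode]
    exact hΦ' e

end Flip

section Estimates

open PoleConfig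

/-! ### Comparison of soliton values -/

section Comparison

variable {N₁ N₂ : ℕ} (a b : Fin 3 → ℝ) {z : PoleIndex N₁ N₂ → ℂ}

lemma norm_potential_factor_le (i j : Fin 3) :
    ‖-Complex.I * ((a i - a j : ℝ) : ℂ)‖ ≤ ∑ i, ∑ j, |a i - a j| := by
  rw [norm_mul, norm_neg, Complex.norm_I, one_mul, Complex.norm_real, Real.norm_eq_abs]
  refine (Finset.single_le_sum (f := fun j => |a i - a j|) (fun _ _ => abs_nonneg _)
    (Finset.mem_univ j)).trans ?_
  exact Finset.single_le_sum (f := fun i => ∑ j, |a i - a j|)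
    (fun _ _ => Finset.sum_nonneg fun _ _ => abs_nonneg _) (Finset.mem_univ i)

/-- Soliton values are bounded uniformly in the norming constants and in `(x, t)`. -/
theorem exists_solitonValue_bound (hz : Function.Injective z) (hz_im : ∀ n, 0 < (z n).im) :
    ∃ C : ℝ, 0 ≤ C ∧ ∀ (S : Finset (PoleIndex N₁ N₂)) (k : PoleIndex N₁ N₂ → ℂ) (x t : ℝ)
      (p : Matrix (Fin 3) (Fin 3) ℂ), IsSolitonValue a b S z k x t p → ∀ i j, ‖p i j‖ ≤ C := by
  classical
  let D := solitonConfig hz hz_im id Function.injective_id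
  obtain ⟨C, hC0, hC⟩ := IsRow.exists_sum_residue_bound D
  refine ⟨(∑ i, ∑ j, |a i - a j|) * C, by positivity, fun S k x t p hp i j => ?_⟩
  obtain ⟨N, φ, hφ, hp'⟩ := hp.exists_rows D rfl (fun _ _ => rfl) (fun _ _ => rfl)
    (K := fun n => if n ∈ S then evolvedNorming a b x t z k n else 0)
    (fun n hn => if_pos hn) (fun n hn => if_neg hn)
  rw [hp', norm_mul]
  exact mul_le_mul (norm_potential_factor_le a i j) (hC _ _ _ _ _ (hφ i)) (norm_nonneg _)
    (by positivity)

/-- Poles with small couplings can be dropped. -/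
theorem exists_bound_of_small_couplings (hz : Function.Injective z) (hz_im : ∀ n, 0 < (z n).im) :
    ∃ C : ℝ, 0 ≤ C ∧ ∀ (S : Finset (PoleIndex N₁ N₂)) (k : PoleIndex N₁ N₂ → ℂ) (x t ε : ℝ)
      (p q : Matrix (Fin 3) (Fin 3) ℂ), (∀ n ∉ S, ‖evolvedNorming a b x t z k n‖ ≤ ε) → 0 ≤ ε →
      IsSolitonValue a b Finset.univ z k x t p → IsSolitonValue a b S z k x t q →
      ∀ i j, ‖p i j - q i j‖ ≤ C * ε := by
  classical
  let D := solitonConfig hz hz_im id Function.injective_id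
  obtain ⟨C, hC0, hC⟩ := IsRow.exists_lipschitz D
  refine ⟨(∑ i, ∑ j, |a i - a j|) * (C * ∑ _n : PoleIndex N₁ N₂, 1), by positivity,
    fun S k x t ε p q hε hε0 hp hq i j => ?_⟩
  obtain ⟨N, φ, hφ, hp'⟩ := hp.exists_rows D rfl (fun _ _ => rfl) (fun _ _ => rfl)
    (K := evolvedNorming a b x t z k) (fun n _ => rfl)
    (fun n hn => absurd (Finset.mem_univ n) hn)
  obtain ⟨M, ψ, hψ, hq'⟩ := hq.exists_rows D rfl (fun _ _ => rfl) (fun _ _ => rfl)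
    (K := fun n => if n ∈ S then evolvedNorming a b x t z k n else 0)
    (fun n hn => if_pos hn) (fun n hn => if_neg hn)
  rw [hp', hq', ← mul_sub, norm_mul, mul_assoc]
  refine mul_le_mul (norm_potential_factor_le a i j) ?_ (norm_nonneg _) (by positivity)
  refine (hC _ _ N M φ ψ hφ hψ i j).trans ?_
  rw [mul_assoc, Finset.sum_mul]
  refine mul_le_mul_of_nonneg_left (Finset.sum_le_sum fun n _ => ?_) hC0
  split_ifs with hn
  · simpa using hε0
  · simpa using hε n hn

/-- The exchange of columns does not change the off-diagonal `1 / z` coefficients, because the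
Blaschke product tends to `1` at infinity. -/
lemma sum_residue_flip (hz : Function.Injective z) (hz_im : ∀ n, 0 < (z n).im)
    {K K' : PoleIndex N₁ N₂ → ℂ} {i j : Fin 3} (hij : j ≠ i) {f : ℂ → Fin 3 → ℂ}
    {φ φ' : PoleIndex N₁ N₂ × Bool → Fin 3 → ℂ}
    (hf : IsRow (solitonConfig hz hz_im id Function.injective_id) K (Pi.single i 1) f φ)
    (hg : IsRow (flippedConfig hz hz_im) K' (Pi.single i 1)
      (fun w => ![f w 0 * firstBlaschke z w, f w 1 * (firstBlaschke z w)⁻¹, f w 2]) φ') :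
    ∑ e, IsRow.residue (flippedConfig hz hz_im) K' φ' j e =
      ∑ e, IsRow.residue (solitonConfig hz hz_im id Function.injective_id) K φ j e := by
  have h1 := hf.tendsto_mul_sub j
  have h2 := hg.tendsto_mul_sub j
  simp only [Pi.single_eq_of_ne hij, sub_zero] at h1 h2
  refine tendsto_nhds_unique h2 ?_
  have hB : Tendsto (firstBlaschke z) (Bornology.cobounded ℂ) (𝓝 1) :=
    tendsto_blaschkeProd_cobounded
  fin_cases j
  · have h3 := h1.mul hB
    rw [mul_one] at h3
    exact h3.congr fun w => by simp [mul_assoc]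
  · have h3 := h1.mul (hB.inv₀ one_ne_zero)
    rw [inv_one, mul_one] at h3
    exact h3.congr fun w => by simp [mul_assoc]
  · exact h1

/-- Poles of the first family with large couplings can be dropped as well, at the price of a
Blaschke factor in the couplings of the second family. -/
theorem exists_bound_of_small_flippedCouplings (hz : Function.Injective z)
    (hz_im : ∀ n, 0 < (z n).im) :
    ∃ C : ℝ, 0 ≤ C ∧ ∀ (S : Finset (PoleIndex N₁ N₂)) (k k' : PoleIndex N₁ N₂ → ℂ) (x t ε : ℝ)
      (p q : Matrix (Fin 3) (Fin 3) ℂ), (∀ m : Fin N₁, .inl m ∉ S) →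
      (∀ m : Fin N₁, k (.inl m) ≠ 0) →
      (∀ m : Fin N₂, k' (.inr m) = k (.inr m) * firstBlaschke z (z (.inr m))) →
      (∀ n ∉ S, ‖flippedCoupling z (evolvedNorming a b x t z k) n‖ ≤ ε) → 0 ≤ ε →
      IsSolitonValue a b Finset.univ z k x t p → IsSolitonValue a b S z k' x t q →
      ∀ i j, ‖p i j - q i j‖ ≤ C * ε := by
  classical
  let D := solitonConfig hz hz_im id Function.injective_id
  let D' := flippedConfig hz hz_im
  obtain ⟨C, hC0, hC⟩ := IsRow.exists_lipschitz D'
  refine ⟨(∑ i, ∑ j, |a i - a j|) * (C * ∑ _n : PoleIndex N₁ N₂, 1), by positivity,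
    fun S k k' x t ε p q hS hk hk' hε hε0 hp hq i j => ?_⟩
  set K := evolvedNorming a b x t z k with hK
  have hKne : ∀ m : Fin N₁, K (.inl m) ≠ 0 := fun m => mul_ne_zero (hk m) (Complex.exp_ne_zero _)
  obtain ⟨N, φ, hφ, hp'⟩ := hp.exists_rows D rfl (fun _ _ => rfl) (fun _ _ => rfl)
    (K := K) (fun n _ => rfl) (fun n hn => absurd (Finset.mem_univ n) hn)
  obtain ⟨M, ψ, hψ, hq'⟩ := hq.exists_rows D' rfl
    (by rintro (m | m) hm; exacts [absurd hm (hS m), rfl])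
    (by rintro (m | m) hm; exacts [absurd hm (hS m), rfl])
    (K := fun n => if n ∈ S then flippedCoupling z K n else 0) (by
      rintro (m | m) hm
      · exact absurd hm (hS m)
      · simp only [if_pos hm, flippedCoupling, hK, evolvedNorming, hk']
        ring)
    (fun n hn => if_neg hn)
  choose φ' hφ' using fun i => (hφ i).flip hz hz_im hKne
  have hp'' : p i j = -Complex.I * ((a i - a j : ℝ) : ℂ) *
      ∑ e, IsRow.residue D' (flippedCoupling z K) (φ' i) j e := by
    rw [hp']
    by_cases hij : j = i
    · subst hij; simp
    · rw [sum_residue_flip hz hz_im hij (hφ i) (hφ' i)]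
  rw [hp'', hq', ← mul_sub, norm_mul, mul_assoc]
  refine mul_le_mul (norm_potential_factor_le a i j) ?_ (norm_nonneg _) (by positivity)
  refine (hC _ _ (fun w i => _) M φ' ψ hφ' hψ i j).trans ?_
  rw [mul_assoc, Finset.sum_mul]
  refine mul_le_mul_of_nonneg_left (Finset.sum_le_sum fun n _ => ?_) hC0
  split_ifs with hn
  · simpa using hε0
  · simpa using hε n hn

end Comparison

/-! ### Size of the couplings in a cone -/

section Cone

variable {N₁ N₂ : ℕ} {a b : Fin 3 → ℝ}

/-- The difference `a_i - a_j` in the phase of the pole `n`. -/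
def gap (a : Fin 3 → ℝ) (n : PoleIndex N₁ N₂) : ℝ := a (srcCol n) - a (tgtCol n)

lemma min_le_gap (a : Fin 3 → ℝ) (n : PoleIndex N₁ N₂) : min (a 0 - a 1) (a 1 - a 2) ≤ gap a n := by
  cases n
  · exact min_le_left _ _
  · exact min_le_right _ _

lemma phase_eq (ha₁ : a 1 < a 0) (ha₂ : a 2 < a 1) (n : PoleIndex N₁ N₂) (x t : ℝ) :
    phase a b (srcCol n) (tgtCol n) x t = gap a n * (x - velocity a b n * t) := by
  have h1 : a 0 - a 1 ≠ 0 := by linarith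
  have h2 : a 1 - a 2 ≠ 0 := by linarith
  cases n
  · simp only [phase, gap, velocity, speed, srcCol, tgtCol]
    field_simp
    ring
  · simp only [phase, gap, velocity, speed, srcCol, tgtCol]
    field_simp
    ring

lemma norm_evolvedNorming (ha₁ : a 1 < a 0) (ha₂ : a 2 < a 1) (x t : ℝ)
    (z k : PoleIndex N₁ N₂ → ℂ) (n : PoleIndex N₁ N₂) :
    ‖evolvedNorming a b x t z k n‖ =
      ‖k n‖ * Real.exp (-((z n).im * (gap a n * (x - velocity a b n * t)))) := by
  rw [evolvedNorming, norm_mul, Complex.norm_exp, phase_eq ha₁ ha₂]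
  congr 2
  simp [Complex.mul_re]

/-- The modification by the reflection coefficient takes only two values, so it is bounded above
and below. -/
lemma exists_modifiedNorming_bound (a b : Fin 3 → ℝ) (r₁ : ℝ → ℂ) (z k : PoleIndex N₁ N₂ → ℂ) :
    ∃ C : ℝ, 0 ≤ C ∧ ∀ ξ n, ‖modifiedNorming a b r₁ ξ z k n‖ ≤ C ∧
      ‖modifiedNorming a b r₁ ξ z k n‖⁻¹ ≤ C := by
  set s := -speed a b 0 1 with hs
  have htwo : ∀ ξ, modifiedNorming a b r₁ ξ z k = modifiedNorming a b r₁ (s - 1) z k ∨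
      modifiedNorming a b r₁ ξ z k = modifiedNorming a b r₁ s z k := by
    have hset : ∀ ξ ξ', (ξ < s ↔ ξ' < s) →
        modifiedNorming a b r₁ ξ z k = modifiedNorming a b r₁ ξ' z k := by
      intro ξ ξ' h
      have hdelta : delta a b r₁ ξ = delta a b r₁ ξ' := by
        funext w
        unfold delta reflectionSet
        rw [propext h]
      funext n
      cases n <;> simp only [modifiedNorming, hdelta]
    intro ξ
    by_cases h : ξ < s
    · exact Or.inl (hset _ _ (by simp [h]))
    · exact Or.inr (hset _ _ (by simp [h]))
  let c : ℝ → PoleIndex N₁ N₂ → ℝ := fun ξ n =>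
    ‖modifiedNorming a b r₁ ξ z k n‖ + ‖modifiedNorming a b r₁ ξ z k n‖⁻¹
  have hc0 : ∀ ξ n, 0 ≤ c ξ n := fun ξ n => by positivity
  have hle : ∀ ξ n, c ξ n ≤ ∑ n, c ξ n := fun ξ n =>
    Finset.single_le_sum (fun n _ => hc0 ξ n) (Finset.mem_univ n)
  have hsum0 : ∀ ξ, 0 ≤ ∑ n, c ξ n := fun ξ => Finset.sum_nonneg fun n _ => hc0 ξ n
  refine ⟨∑ n, c (s - 1) n + ∑ n, c s n, add_nonneg (hsum0 _) (hsum0 _), fun ξ n => ?_⟩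
  have hn : c ξ n ≤ ∑ n, c (s - 1) n + ∑ n, c s n := by
    rcases htwo ξ with h | h
    · have : c ξ n = c (s - 1) n := by simp only [c, h]
      linarith [hle (s - 1) n, hsum0 s]
    · have : c ξ n = c s n := by simp only [c, h]
      linarith [hle s n, hsum0 (s - 1)]
  constructor
  · refine le_trans ?_ hn
    exact le_add_of_nonneg_right (by positivity)
  · refine le_trans ?_ hn
    exact le_add_of_nonneg_left (by positivity)

lemma modifiedNorming_ne_zero {r₁ : ℝ → ℂ} {ξ : ℝ} {z k : PoleIndex N₁ N₂ → ℂ}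
    {n : PoleIndex N₁ N₂} (hk : k n ≠ 0) : modifiedNorming a b r₁ ξ z k n ≠ 0 := by
  cases n
  · exact mul_ne_zero hk (inv_ne_zero (pow_ne_zero _ (Complex.exp_ne_zero _)))
  · exact mul_ne_zero hk (Complex.exp_ne_zero _)

/-- The decay of the exponential factor of a pole outside the cone: there `y = ± (x - v t)`, with
`v` the velocity of the pole, and `r` is its distance to the interval of cone velocities. -/
lemma exp_neg_le {y g g₀ X σ μ t : ℝ} (hσ : 0 < σ) (hg : g₀ ≤ g) (hg₀ : 0 < g₀) (ht : 0 ≤ t)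
    {r : ℝ} (hr : 0 ≤ r) (hμ : μ ≤ σ * r) (hy : -X + r * t ≤ y) :
    Real.exp (-(σ * (g * y))) ≤ Real.exp (σ * (g * X)) * Real.exp (-g₀ * μ * t) := by
  rw [← Real.exp_add, Real.exp_le_exp]
  have h1 : σ * (g * (-X + r * t)) ≤ σ * (g * y) := by
    have : 0 < g := hg₀.trans_le hg
    gcongr
  have h2 : g₀ * μ * t ≤ g * (σ * r) * t := by
    refine mul_le_mul_of_nonneg_right ?_ ht
    calc g₀ * μ ≤ g₀ * (σ * r) := by gcongr
      _ ≤ g * (σ * r) := by gcongr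
  linarith [h1, h2, show σ * (g * (-X + r * t)) = -(σ * (g * X)) + g * (σ * r) * t by ring]

lemma exists_exp_bound (a : Fin 3 → ℝ) (z : PoleIndex N₁ N₂ → ℂ) (X : ℝ) :
    ∃ C : ℝ, 0 ≤ C ∧ ∀ n, Real.exp ((z n).im * (gap a n * X)) ≤ C :=
  ⟨∑ n, Real.exp ((z n).im * (gap a n * X)), Finset.sum_nonneg fun _ _ => (Real.exp_pos _).le,
    fun n => Finset.single_le_sum (f := fun n => Real.exp ((z n).im * (gap a n * X)))
      (fun _ _ => (Real.exp_pos _).le) (Finset.mem_univ n)⟩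

lemma cone_bounds {x₁ x₂ v₁ v₂ x t : ℝ} (ht : 0 ≤ t) (h : (x, t) ∈ cone x₁ x₂ v₁ v₂) :
    -(|x₁| + |x₂|) + v₁ * t ≤ x ∧ x ≤ |x₁| + |x₂| + v₂ * t := by
  obtain ⟨x₀, hx₀, v, hv, h⟩ := h
  simp only at h
  have h1 := mul_le_mul_of_nonneg_right hv.1 ht
  have h2 := mul_le_mul_of_nonneg_right hv.2 ht
  constructor
  · linarith [hx₀.1, neg_abs_le x₁, abs_nonneg x₂]
  · linarith [hx₀.2, le_abs_self x₂, abs_nonneg x₁]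

lemma notMem_retained {v₁ v₂ : ℝ} {n : PoleIndex N₁ N₂} :
    n ∉ retained N₁ N₂ a b v₁ v₂ ↔ n ∈ discarded N₁ N₂ a b v₁ v₂ := by
  simp [retained, discarded]

lemma mem_discarded {v₁ v₂ : ℝ} {n : PoleIndex N₁ N₂} :
    n ∈ discarded N₁ N₂ a b v₁ v₂ ↔ velocity a b n ∉ Set.Ioo v₁ v₂ := by
  simp [discarded]

lemma coneNorming_eq_of_le {v₂ : ℝ} (h₁ : -speed a b 0 1 ≤ v₂) (h₂ : -speed a b 1 2 ≤ v₂)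
    (z c : PoleIndex N₁ N₂ → ℂ) : coneNorming a b z c v₂ = c := by
  funext n
  cases n
  · simp [coneNorming, blaschke₂, velocity, not_lt.2 h₂]
  · simp [coneNorming, blaschke₁, velocity, not_lt.2 h₁]

lemma blaschke₁_eq {v₂ : ℝ} (h₁ : v₂ < -speed a b 0 1) (z : PoleIndex N₁ N₂ → ℂ) :
    blaschke₁ a b z v₂ = firstBlaschke z := by
  funext w
  simp [blaschke₁, velocity, h₁, firstBlaschke, blaschkeProd]

lemma mu_pos {z : PoleIndex N₁ N₂ → ℂ} (hz_im : ∀ n, 0 < (z n).im) {v₁ v₂ : ℝ}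
    (h : (discarded N₁ N₂ a b v₁ v₂).Nonempty)
    (hv : ∀ n : PoleIndex N₁ N₂, velocity a b n ≠ v₁ ∧ velocity a b n ≠ v₂) :
    0 < mu a b z v₁ v₂ h := by
  rw [mu, Finset.lt_inf'_iff]
  exact fun n _ => mul_pos (hz_im n) (lt_min (abs_pos.2 (sub_ne_zero.2 (hv n).1.symm))
    (abs_pos.2 (sub_ne_zero.2 (hv n).2.symm)))

lemma mu_nonneg {z : PoleIndex N₁ N₂ → ℂ} (hz_im : ∀ n, 0 < (z n).im) {v₁ v₂ : ℝ}
    (h : (discarded N₁ N₂ a b v₁ v₂).Nonempty) : 0 ≤ mu a b z v₁ v₂ h := by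
  rw [mu, Finset.le_inf'_iff]
  exact fun n _ => mul_nonneg (hz_im n).le (le_min (abs_nonneg _) (abs_nonneg _))

end Cone

end Estimates

section Cones

/-! ### The error estimate in a cone -/

section Estimate

variable {N₁ N₂ : ℕ} {a b : Fin 3 → ℝ} {z : PoleIndex N₁ N₂ → ℂ}

/-- If the cone is slower than `-n₁₃`, then it eventually leaves both regimes. -/
lemma exists_forall_not_inRegime (hn₁ : speed a b 0 1 < speed a b 0 2) {x₁ x₂ v₁ v₂ : ℝ}
    (hv₂ : v₂ < -speed a b 0 2) :
    ∃ T : ℝ, 0 < T ∧ ∀ x t : ℝ, T ≤ t → (x, t) ∈ cone x₁ x₂ v₁ v₂ → ¬ InRegime a b x t := by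
  have hpos : 0 < -speed a b 0 2 - v₂ := by linarith
  refine ⟨max 1 ((|x₁| + |x₂|) / (-speed a b 0 2 - v₂)), lt_max_of_lt_left one_pos,
    fun x t ht hx hreg => ?_⟩
  have ht0 : 0 < t := one_pos.trans_le ((le_max_left _ _).trans ht)
  have h1 := (le_max_right _ _).trans ht
  rw [div_le_iff₀ hpos] at h1
  have h2 : -speed a b 0 2 < x / t := by
    rcases hreg with h | h
    · linarith
    · exact h.1
  rw [lt_div_iff₀ ht0] at h2
  linarith [(cone_bounds ht0.le hx).2]

/-- In a cone that is not slower than the soliton of a discarded pole, the evolved norming constant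
of that pole is exponentially small. -/
lemma exists_slow_coupling_bound (ha₁ : a 1 < a 0) (ha₂ : a 2 < a 1) (hz_im : ∀ n, 0 < (z n).im)
    (c : PoleIndex N₁ N₂ → ℂ) (r₁ : ℝ → ℂ) (x₁ x₂ v₁ v₂ : ℝ)
    (h : (discarded N₁ N₂ a b v₁ v₂).Nonempty) (hμ : 0 < mu a b z v₁ v₂ h) :
    ∃ C : ℝ, 0 ≤ C ∧ ∀ n ∈ discarded N₁ N₂ a b v₁ v₂, velocity a b n ≤ v₂ →
      ∀ x t ξ : ℝ, 0 ≤ t → (x, t) ∈ cone x₁ x₂ v₁ v₂ →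
      ‖evolvedNorming a b x t z (modifiedNorming a b r₁ ξ z c) n‖ ≤
        C * Real.exp (-(min (a 0 - a 1) (a 1 - a 2)) * mu a b z v₁ v₂ h * t) := by
  obtain ⟨C₁, hC₁, hC₁'⟩ := exists_modifiedNorming_bound a b r₁ z c
  obtain ⟨C₂, hC₂, hC₂'⟩ := exists_exp_bound a z (|x₁| + |x₂|)
  refine ⟨C₁ * C₂, by positivity, fun n hn hvel x t ξ ht hx => ?_⟩
  have hle : mu a b z v₁ v₂ h ≤ (z n).im * min |v₁ - velocity a b n| |v₂ - velocity a b n| :=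
    Finset.inf'_le _ hn
  have hmin : 0 < min |v₁ - velocity a b n| |v₂ - velocity a b n| :=
    (mul_pos_iff_of_pos_left (hz_im n)).1 (hμ.trans_le hle)
  have hne : velocity a b n ≠ v₂ := fun he => by
    have := hmin.trans_le (min_le_right _ _)
    simp [he] at this
  have hslow : velocity a b n ≤ v₁ := by
    by_contra hlt
    exact mem_discarded.1 hn ⟨not_le.1 hlt, lt_of_le_of_ne hvel hne⟩
  have hle' : mu a b z v₁ v₂ h ≤ (z n).im * (v₁ - velocity a b n) := by
    refine hle.trans (mul_le_mul_of_nonneg_left ?_ (hz_im n).le)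
    exact (min_le_left _ _).trans_eq (abs_of_nonneg (sub_nonneg.2 hslow))
  rw [norm_evolvedNorming ha₁ ha₂, mul_assoc]
  refine mul_le_mul (hC₁' ξ n).1 ?_ (Real.exp_pos _).le hC₁
  refine (exp_neg_le (hz_im n) (min_le_gap a n) (lt_min (by linarith) (by linarith)) ht
    (sub_nonneg.2 hslow) hle' (X := |x₁| + |x₂|) ?_).trans ?_
  · linarith [(cone_bounds ht hx).1]
  · exact mul_le_mul_of_nonneg_right (hC₂' n) (Real.exp_pos _).le

/-- In a cone that is slower than the soliton of a pole, the inverse of the evolved norming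
constant of that pole is exponentially small. -/
lemma exists_fast_coupling_bound (ha₁ : a 1 < a 0) (ha₂ : a 2 < a 1) (hz_im : ∀ n, 0 < (z n).im)
    (c : PoleIndex N₁ N₂ → ℂ) (r₁ : ℝ → ℂ) (x₁ x₂ v₁ v₂ : ℝ)
    (h : (discarded N₁ N₂ a b v₁ v₂).Nonempty) :
    ∃ C : ℝ, 0 ≤ C ∧ ∀ n, v₂ < velocity a b n →
      ∀ x t ξ : ℝ, 0 ≤ t → (x, t) ∈ cone x₁ x₂ v₁ v₂ →
      ‖evolvedNorming a b x t z (modifiedNorming a b r₁ ξ z c) n‖⁻¹ ≤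
        C * Real.exp (-(min (a 0 - a 1) (a 1 - a 2)) * mu a b z v₁ v₂ h * t) := by
  obtain ⟨C₁, hC₁, hC₁'⟩ := exists_modifiedNorming_bound a b r₁ z c
  obtain ⟨C₂, hC₂, hC₂'⟩ := exists_exp_bound a z (|x₁| + |x₂|)
  refine ⟨C₁ * C₂, by positivity, fun n hvel x t ξ ht hx => ?_⟩
  have hn : n ∈ discarded N₁ N₂ a b v₁ v₂ := mem_discarded.2 fun hm => hvel.not_gt hm.2
  have hle' : mu a b z v₁ v₂ h ≤ (z n).im * (velocity a b n - v₂) := by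
    refine (Finset.inf'_le _ hn).trans (mul_le_mul_of_nonneg_left ?_ (hz_im n).le)
    refine (min_le_right _ _).trans_eq ?_
    rw [abs_sub_comm]
    exact abs_of_pos (sub_pos.2 hvel)
  rw [norm_evolvedNorming ha₁ ha₂, mul_inv, ← Real.exp_neg, mul_assoc]
  refine mul_le_mul (hC₁' ξ n).2 ?_ (Real.exp_pos _).le hC₁
  have hexp := exp_neg_le (y := -(x - velocity a b n * t)) (hz_im n) (min_le_gap a n)
    (lt_min (by linarith) (by linarith)) ht (sub_pos.2 hvel).le hle' (X := |x₁| + |x₂|)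
    (by linarith [(cone_bounds ht hx).2])
  rw [mul_neg, mul_neg] at hexp
  exact hexp.trans (mul_le_mul_of_nonneg_right (hC₂' n) (Real.exp_pos _).le)

/-- The full soliton value and the soliton value of the cone differ by an exponentially small
error. -/
theorem exists_cone_error_bound (ha₁ : a 1 < a 0) (ha₂ : a 2 < a 1)
    (hn₁ : speed a b 0 1 < speed a b 0 2) (hn₂ : speed a b 0 2 < speed a b 1 2)
    (hz : Function.Injective z) (hz_im : ∀ n, 0 < (z n).im)
    (c : PoleIndex N₁ N₂ → ℂ) (hc : ∀ n, c n ≠ 0) (r₁ : ℝ → ℂ) (x₁ x₂ v₁ v₂ : ℝ)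
    (h : (discarded N₁ N₂ a b v₁ v₂).Nonempty) :
    ∃ K T : ℝ, 0 < T ∧ ∀ x t : ℝ, T ≤ t → (x, t) ∈ cone x₁ x₂ v₁ v₂ → InRegime a b x t →
      ∀ p q, IsFullSolitonValue a b z c r₁ x t p → IsConeSolitonValue a b z c r₁ v₁ v₂ x t q →
        ∀ i j, ‖p i j - q i j‖ ≤
          K * Real.exp (-(min (a 0 - a 1) (a 1 - a 2)) * mu a b z v₁ v₂ h * t) := by
  obtain hμ | hμ := (mu_nonneg hz_im h).eq_or_lt
  · -- without decay, the uniform bound on soliton values suffices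
    obtain ⟨C, -, hC⟩ := exists_solitonValue_bound a b hz hz_im
    refine ⟨C + C, 1, one_pos, fun x t _ _ _ p q hp hq i j => ?_⟩
    rw [← hμ, mul_zero, zero_mul, Real.exp_zero, mul_one]
    exact (norm_sub_le _ _).trans (add_le_add (hC _ _ _ _ _ hp i j) (hC _ _ _ _ _ hq i j))
  obtain hA | hA := lt_or_ge v₂ (-speed a b 0 2)
  · obtain ⟨T, hT, hreg⟩ := exists_forall_not_inRegime (x₁ := x₁) (x₂ := x₂) (v₁ := v₁) hn₁ hA
    exact ⟨0, T, hT, fun x t ht hx hr => absurd hr (hreg x t ht hx)⟩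
  have hinr : ∀ m : Fin N₂, velocity a b (.inr m : PoleIndex N₁ N₂) ≤ v₂ := fun m => by
    simp only [velocity]; linarith
  obtain ⟨C₁, hC₁, hslow⟩ :=
    exists_slow_coupling_bound ha₁ ha₂ hz_im c r₁ x₁ x₂ v₁ v₂ h hμ
  set E : ℝ → ℝ := fun t => Real.exp (-(min (a 0 - a 1) (a 1 - a 2)) * mu a b z v₁ v₂ h * t)
    with hE
  have hE0 : ∀ t, 0 ≤ E t := fun t => (Real.exp_pos _).le
  obtain hB | hB := lt_or_ge v₂ (-speed a b 0 1)
  · -- the first family is faster than the cone: its couplings grow and are inverted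
    obtain ⟨C₂, hC₂, hfast⟩ := exists_fast_coupling_bound ha₁ ha₂ hz_im c r₁ x₁ x₂ v₁ v₂ h
    obtain ⟨C, hC0, hC⟩ := exists_bound_of_small_flippedCouplings a b hz hz_im
    set β : Fin N₁ → ℂ := blaschkeResidue fun m : Fin N₁ => z (.inl m)
    set A : ℝ := ∑ m, ‖β m ^ 2‖ * C₂ + ∑ m : Fin N₂, C₁ * ‖firstBlaschke z (z (.inr m))‖ with hAdef
    have hA1 : ∀ m, ‖β m ^ 2‖ * C₂ ≤ A := fun m =>
      (Finset.single_le_sum (f := fun m => ‖β m ^ 2‖ * C₂) (fun _ _ => by positivity)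
        (Finset.mem_univ m)).trans (le_add_of_nonneg_right (by positivity))
    have hA2 : ∀ m : Fin N₂, C₁ * ‖firstBlaschke z (z (.inr m))‖ ≤ A := fun m =>
      (Finset.single_le_sum (f := fun m : Fin N₂ => C₁ * ‖firstBlaschke z (z (.inr m))‖)
        (fun _ _ => by positivity) (Finset.mem_univ m)).trans
        (le_add_of_nonneg_left (by positivity))
    refine ⟨C * A, 1, one_pos, fun x t ht hx _ p q hp hq i j => ?_⟩
    have ht0 : 0 ≤ t := zero_le_one.trans ht
    rw [mul_assoc]
    refine hC _ _ _ x t (A * E t) p q (fun m hm => ?_) (fun m => modifiedNorming_ne_zero (hc _))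
      (fun m => ?_) (fun n hn => ?_) (by positivity) hp hq i j
    · have : velocity a b (.inl m : PoleIndex N₁ N₂) ∈ Set.Ioo v₁ v₂ := by
        simpa [retained] using hm
      exact lt_asymm hB this.2
    · simp only [modifiedNorming, coneNorming, blaschke₁_eq hB]
      ring
    · rw [notMem_retained] at hn
      rcases n with m | m
      · have h1 := hfast (.inl m) hB x t (x / t) ht0 hx
        rw [flippedCoupling, norm_div, div_eq_mul_inv]
        calc _ ≤ ‖β m ^ 2‖ * (C₂ * E t) := by gcongr
          _ = ‖β m ^ 2‖ * C₂ * E t := by ring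
          _ ≤ A * E t := mul_le_mul_of_nonneg_right (hA1 m) (hE0 t)
      · have h1 := hslow (.inr m) hn (hinr m) x t (x / t) ht0 hx
        rw [flippedCoupling, norm_mul]
        calc _ ≤ C₁ * E t * ‖firstBlaschke z (z (.inr m))‖ := by gcongr
          _ = C₁ * ‖firstBlaschke z (z (.inr m))‖ * E t := by ring
          _ ≤ A * E t := mul_le_mul_of_nonneg_right (hA2 m) (hE0 t)
  · -- all discarded poles are slower than the cone
    obtain ⟨C, hC0, hC⟩ := exists_bound_of_small_couplings a b hz hz_im
    refine ⟨C * C₁, 1, one_pos, fun x t ht hx _ p q hp hq i j => ?_⟩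
    have ht0 : 0 ≤ t := zero_le_one.trans ht
    rw [mul_assoc]
    rw [IsConeSolitonValue, coneNorming_eq_of_le hB (by linarith)] at hq
    refine hC _ _ x t (C₁ * E t) p q (fun n hn => ?_) (by positivity) hp hq i j
    rw [notMem_retained] at hn
    refine hslow n hn ?_ x t (x / t) ht0 hx
    rcases n with m | m
    · exact hB
    · exact hinr m

theorem eq_of_discarded_eq_empty (hz : Function.Injective z) (hz_im : ∀ n, 0 < (z n).im)
    {c : PoleIndex N₁ N₂ → ℂ} {r₁ : ℝ → ℂ} {v₁ v₂ x t : ℝ}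
    (h : discarded N₁ N₂ a b v₁ v₂ = ∅) {p q : Matrix (Fin 3) (Fin 3) ℂ}
    (hp : IsFullSolitonValue a b z c r₁ x t p) (hq : IsConeSolitonValue a b z c r₁ v₁ v₂ x t q) :
    p = q := by
  have hmem : ∀ n : PoleIndex N₁ N₂, velocity a b n ∈ Set.Ioo v₁ v₂ := fun n => by
    by_contra hn
    have := mem_discarded.2 hn
    simp [h] at this
  have hret : retained N₁ N₂ a b v₁ v₂ = Finset.univ := by
    ext n; simpa [retained] using hmem n
  have hcone : coneNorming a b z c v₂ = c := by
    have hlt : ∀ n : PoleIndex N₁ N₂, ¬ v₂ < velocity a b n := fun n => (hmem n).2.not_gt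
    funext n
    cases n <;> simp [coneNorming, blaschke₁, blaschke₂, hlt]
  rw [IsConeSolitonValue, hret, hcone] at hq
  exact hp.unique hz hz_im hq

end Estimate

end Cones

end ThreeWave

theorem mainTheorem3 {N₁ N₂ : ℕ} (a b : Fin 3 → ℝ)
    (ha₁ : a 1 < a 0) (ha₂ : a 2 < a 1)
    (hn₁ : ThreeWave.speed a b 0 1 < ThreeWave.speed a b 0 2)
    (hn₂ : ThreeWave.speed a b 0 2 < ThreeWave.speed a b 1 2)
    (z : ThreeWave.PoleIndex N₁ N₂ → ℂ) (hz : Function.Injective z) (hz_im : ∀ n, 0 < (z n).im)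
    (c : ThreeWave.PoleIndex N₁ N₂ → ℂ) (hc : ∀ n, c n ≠ 0)
    (r₁ : ℝ → ℂ) (hr₁ : MeasureTheory.MemLp r₁ 2 MeasureTheory.volume)
    (x₁ x₂ v₁ v₂ : ℝ) (hx : x₁ ≤ x₂) (hv : v₁ ≤ v₂) :
    -- both soliton solutions are well defined
    (∀ x t : ℝ, 0 < t → ThreeWave.InRegime a b x t →
      (∃! p, ThreeWave.IsFullSolitonValue a b z c r₁ x t p) ∧
      (∃! q, ThreeWave.IsConeSolitonValue a b z c r₁ v₁ v₂ x t q)) ∧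
    -- they differ by an exponentially small error, uniformly in the cone
    (∀ h : (ThreeWave.discarded N₁ N₂ a b v₁ v₂).Nonempty,
      ((∀ n : ThreeWave.PoleIndex N₁ N₂, ThreeWave.velocity a b n ≠ v₁ ∧
          ThreeWave.velocity a b n ≠ v₂) → 0 < ThreeWave.mu a b z v₁ v₂ h) ∧
      ∃ K T : ℝ, 0 < T ∧ ∀ x t : ℝ, T ≤ t → (x, t) ∈ ThreeWave.cone x₁ x₂ v₁ v₂ →
        ThreeWave.InRegime a b x t →
        ∀ p q, ThreeWave.IsFullSolitonValue a b z c r₁ x t p →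
          ThreeWave.IsConeSolitonValue a b z c r₁ v₁ v₂ x t q →
          ∀ i j, ‖p i j - q i j‖ ≤
            K * Real.exp (-(min (a 0 - a 1) (a 1 - a 2)) * ThreeWave.mu a b z v₁ v₂ h * t)) ∧
    -- if no pole is discarded, there is no error
    (ThreeWave.discarded N₁ N₂ a b v₁ v₂ = ∅ →
      ∀ x t : ℝ, 0 < t → ThreeWave.InRegime a b x t →
        ∀ p q, ThreeWave.IsFullSolitonValue a b z c r₁ x t p →
          ThreeWave.IsConeSolitonValue a b z c r₁ v₁ v₂ x t q → p = q) := by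
  exact ⟨fun x t _ _ => ⟨ThreeWave.existsUnique_isSolitonValue a b _ hz hz_im _ x t,
      ThreeWave.existsUnique_isSolitonValue a b _ hz hz_im _ x t⟩,
    fun h => ⟨ThreeWave.mu_pos hz_im h,
      ThreeWave.exists_cone_error_bound ha₁ ha₂ hn₁ hn₂ hz hz_im c hc r₁ x₁ x₂ v₁ v₂ h⟩,
    fun h x t _ _ p q hp hq => ThreeWave.eq_of_discarded_eq_empty hz hz_im h hp hq⟩
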